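/- Let $H$ be a separable complex Hilbert space, $\mathcal L(H)$ the bounded operators on $H$, and $H\otimes H$ the Hilbert space tensor product. A channel (in the Heisenberg picture) is a normal, unital, completely positive linear map; a von Neumann algebra is understood abstractly, as a $C^*$-algebra that is isometrically isomorphic to the dual of a Banach space; $\mathrm{Fix}(\Lambda)=\{A\in\mathcal L(H): \Lambda(A)=A\}$. **(1)** Let $\Phi^*:\mathcal L(H\otimes H)\to\mathcal L(H)$ be a symmetric channel, i.e. a channel with $\Phi^*(A\otimes B)=\Phi^*(B\otimes A)$ for all $A,B\in\mathcal L(H)$, and let $\Phi_0^*(A)=\Phi^*(A\otimes I)=\Phi^*(I\otimes A)$ be its marginal. There is an idempotent completely positive map $\psi_0:\mathcal L(H)\to\mathcal L(H)$ with $\psi_0\circ\Phi_0^*=\psi_0$ and $\psi_0(\mathcal L(H))=\mathrm{Fix}(\Phi_0^*)$ which is the limit of a subnet of the means $\frac1n\sum_{k=0}^{n-1}(\Phi_0^*)^k$ in the point-ultraweak topology (the one generated by the maps $\mathcal E\mapsto\mathrm{tr}[T\mathcal E(A)]$ with $A\in\mathcal L(H)$ and $T$ trace-class). For every idempotent completely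 positive map $\psi_0$ with $\psi_0\circ\Phi_0^*=\psi_0$ and $\psi_0(\mathcal L(H))=\mathrm{Fix}(\Phi_0^*)$, the product $$(A,B)\mapsto \psi_0\big(\Phi^*(A\otimes B)\big)$$ makes $\mathrm{Fix}(\Phi_0^*)$ a commutative von Neumann algebra with unit $I$, with respect to the linear structure, the operator norm and the involution inherited from $\mathcal L(H)$. **(2)** Let $\Omega$ be a standard Borel space, $G$ a POVM on $\Omega$ with values in $\mathcal L(H)$, $(\sigma_\lambda)_{\lambda\in\Omega}$ a family of density operators such that $\lambda\mapsto\mathrm{tr}[\sigma_\lambda A]$ is measurable for every $A\in\mathcal L(H)$, and let $\Lambda^*(A)=\int_\Omega\mathrm{tr}[\sigma_\lambda A]\,dG(\lambda)$ be the corresponding entanglement breaking channel. Then there is a product which makes $\mathrm{Fix}(\Lambda^*)$ a commutative von Neumann algebra with unit $I$, with the linear structure, norm and involution inherited from $\mathcal L(H)$. Moreover, $\Lambda^*$ is the marginal of the symmetric channel $\Phi^*(C)=\int_\Omega\mathrm{tr}[(\sigma_\lambda\otimes\sigma_\lambda)C]\,dG(\lambda)$, so that by (1) such a product is $(A,B)\mapsto\psi_0(\Phi^*(A\otimes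 B))$. -/

import Mathlib

open scoped TensorProduct CStarAlgebra
open MeasureTheory Filter Topology

noncomputable section

namespace QChannel

universe u w

/-! ### Trace-class operators, trace, states -/

section Trace

variable {H : Type u} [NormedAddCommGroup H] [InnerProductSpace ℂ H]

/-- `T` is a trace-class (nuclear) operator: `T = ∑ₙ |yₙ⟩⟨xₙ|` with `∑ₙ ‖xₙ‖ ‖yₙ‖ < ∞`. -/
def IsTraceClass (T : H →L[ℂ] H) : Prop :=
  ∃ x y : ℕ → H, Summable (fun n => ‖x n‖ * ‖y n‖) ∧
    ∀ v : H, HasSum (fun n => inner ℂ (x n) v • y n) (T v)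

/-- The trace `∑ᵢ ⟨bᵢ, T bᵢ⟩` along a Hilbert basis `b`. For trace-class `T` the series converges
absolutely and its sum does not depend on the basis; it is only used for such `T`. -/
def trace [CompleteSpace H] (T : H →L[ℂ] H) : ℂ :=
  ∑' i, inner ℂ ((exists_hilbertBasis ℂ H).choose_spec.choose i)
    (T ((exists_hilbertBasis ℂ H).choose_spec.choose i))

/-- States of the quantum system: density operators. -/
structure IsDensityOperator [CompleteSpace H] (ρ : H →L[ℂ] H) : Prop where
  isPositive : ρ.IsPositive
  isTraceClass : IsTraceClass ρ
  trace_eq_one : trace ρ = 1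

end Trace

/-! ### The Hilbert space tensor product -/

section Tensor

variable (H : Type u) [NormedAddCommGroup H] [InnerProductSpace ℂ H]

/-- The Hilbert space tensor product `H ⊗ H`: the completion of the algebraic tensor product. -/
abbrev HilbertTensor : Type u := UniformSpace.Completion (H ⊗[ℂ] H)

variable {H}

/-- The bounded operator `A ⊗ B` on `H ⊗ H`. -/
def opTensor (A B : H →L[ℂ] H) : HilbertTensor H →L[ℂ] HilbertTensor H :=
  (TensorProduct.mapL A B).completion

theorem opTensor_apply_coe (A B : H →L[ℂ] H) (t : H ⊗[ℂ] H) :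
    opTensor A B (t : HilbertTensor H) = (TensorProduct.mapL A B t : H ⊗[ℂ] H) :=
  ContinuousLinearMap.completion_apply_coe _ _

theorem opTensor_add_left (A₁ A₂ B : H →L[ℂ] H) :
    opTensor (A₁ + A₂) B = opTensor A₁ B + opTensor A₂ B := by
  ext v
  induction v using UniformSpace.Completion.induction_on with
  | hp => exact isClosed_eq (by fun_prop) (by fun_prop)
  | ih t =>
    rw [_root_.add_apply, opTensor_apply_coe, opTensor_apply_coe, opTensor_apply_coe,
      TensorProduct.mapL_add_left, _root_.add_apply, UniformSpace.Completion.coe_add]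

theorem opTensor_smul_left (c : ℂ) (A B : H →L[ℂ] H) :
    opTensor (c • A) B = c • opTensor A B := by
  ext v
  change opTensor (c • A) B v = c • opTensor A B v
  induction v using UniformSpace.Completion.induction_on with
  | hp =>
    exact isClosed_eq (opTensor (c • A) B).continuous ((opTensor A B).continuous.const_smul c)
  | ih t =>
    rw [opTensor_apply_coe, opTensor_apply_coe, TensorProduct.mapL_smul_left,
      ← UniformSpace.Completion.coe_smul]
    rfl

end Tensor

/-! ### Channels in the Heisenberg picture -/

section Channel

variable {H : Type u} [NormedAddCommGroup H] [InnerProductSpace ℂ H] [CompleteSpace H]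
variable {K : Type u} [NormedAddCommGroup K] [InnerProductSpace ℂ K] [CompleteSpace K]

/-- A completely positive map `Φ : L(K) → L(H)` is a (Heisenberg picture) quantum channel if it is
unital and normal, i.e. it is the dual of a map from trace-class operators on `H` to trace-class
operators on `K`: `tr (T Φ(A)) = tr (T' A)`. -/
structure IsChannel (Φ : (K →L[ℂ] K) →CP (H →L[ℂ] H)) : Prop where
  map_one : Φ 1 = 1
  normal : ∀ T : H →L[ℂ] H, IsTraceClass T → ∃ T' : K →L[ℂ] K, IsTraceClass T' ∧
    ∀ A : K →L[ℂ] K, trace (T * Φ A) = trace (T' * A)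

/-- A symmetric channel: `Φ(A ⊗ B) = Φ(B ⊗ A)` for all `A, B`. -/
structure IsSymmetricChannel
    (Φ : (HilbertTensor H →L[ℂ] HilbertTensor H) →CP (H →L[ℂ] H)) : Prop where
  isChannel : IsChannel Φ
  symm : ∀ A B : H →L[ℂ] H, Φ (opTensor A B) = Φ (opTensor B A)

/-- The marginal `Φ₀(A) = Φ(A ⊗ 1)`. -/
def marginal (Φ : (HilbertTensor H →L[ℂ] HilbertTensor H) →CP (H →L[ℂ] H)) :
    (H →L[ℂ] H) →ₗ[ℂ] (H →L[ℂ] H) where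
  toFun A := Φ (opTensor A 1)
  map_add' A B := by rw [opTensor_add_left, map_add]
  map_smul' c A := by rw [opTensor_smul_left, map_smul, RingHom.id_apply]

/-- The space of fixed points of a linear map on `L(H)`. -/
def fixedPoints (Λ : (H →L[ℂ] H) →ₗ[ℂ] (H →L[ℂ] H)) : Submodule ℂ (H →L[ℂ] H) :=
  LinearMap.eqLocus Λ LinearMap.id

/-- `ψ` is an idempotent completely positive map with `ψ ∘ Λ = ψ` and `ψ(L(H)) = Fix Λ`. -/
structure IsFixedPointProjection (Λ : (H →L[ℂ] H) →ₗ[ℂ] (H →L[ℂ] H))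
    (ψ : (H →L[ℂ] H) →CP (H →L[ℂ] H)) : Prop where
  idempotent : ∀ A, ψ (ψ A) = ψ A
  comp_eq : ∀ A, ψ (Λ A) = ψ A
  range_eq : Set.range ψ = fixedPoints Λ

/-- `ψ` is the limit of a subnet of the Cesàro means `(1/n) ∑_{k<n} Λᵏ` in the point-ultraweak
topology, i.e. the topology generated by the maps `ℰ ↦ tr (T ℰ(A))`, `A` bounded,
`T` trace-class. -/
def IsCesaroLimit (Λ : (H →L[ℂ] H) →ₗ[ℂ] (H →L[ℂ] H))
    (ψ : (H →L[ℂ] H) →CP (H →L[ℂ] H)) : Prop :=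
  ∃ F : Filter ℕ, F.NeBot ∧ F ≤ atTop ∧ ∀ A T : H →L[ℂ] H, IsTraceClass T →
    Tendsto (fun n : ℕ => trace (T * ((n : ℂ)⁻¹ • ∑ k ∈ Finset.range n, (Λ ^ k) A))) F
      (𝓝 (trace (T * ψ A)))

/-- The product `m` makes the operator space `V` into a commutative (abstract) von Neumann algebra
with unit `1`, whose linear structure, norm and involution are those of `L(H)`: there are a
commutative unital C⋆-algebra `M` with a Banach space predual and a linear isometric bijection
of `M` onto `V` carrying the unit, the involution and the product of `M` to the identity
operator, the adjoint and `m`. -/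
def IsCommVonNeumannProduct (V : Submodule ℂ (H →L[ℂ] H)) (m : V → V → (H →L[ℂ] H)) : Prop :=
  ∃ (M : Type u) (_ : CommCStarAlgebra M) (e : M ≃ₗᵢ[ℂ] V), WStarAlgebra M ∧
    ((e 1 : V) : H →L[ℂ] H) = 1 ∧
    (∀ a : M, ((e (star a) : V) : H →L[ℂ] H) = star ((e a : V) : H →L[ℂ] H)) ∧
    ∀ a b : M, ((e (a * b) : V) : H →L[ℂ] H) = m (e a) (e b)

/-- The product `(A, B) ↦ ψ(Φ(A ⊗ B))` on the fixed points of the marginal of `Φ`. -/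
def broadcastProduct (Φ : (HilbertTensor H →L[ℂ] HilbertTensor H) →CP (H →L[ℂ] H))
    (ψ : (H →L[ℂ] H) →CP (H →L[ℂ] H)) (A B : fixedPoints (marginal Φ)) : H →L[ℂ] H :=
  ψ (Φ (opTensor (A : H →L[ℂ] H) (B : H →L[ℂ] H)))

end Channel

/-! ### POVMs and entanglement breaking channels -/

section EB

variable {H : Type u} [NormedAddCommGroup H] [InnerProductSpace ℂ H] [CompleteSpace H]
variable {Ω : Type w} [MeasurableSpace Ω]

/-- `μ` is the outcome distribution `X ↦ tr (ρ G(X))` of `G` in the state `ρ`. -/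
def IsOutcomeMeasure (G : Set Ω → (H →L[ℂ] H)) (ρ : H →L[ℂ] H) (μ : Measure Ω) : Prop :=
  IsProbabilityMeasure μ ∧ ∀ X, MeasurableSet X → trace (ρ * G X) = (μ.real X : ℂ)

/-- A POVM: for every state `ρ`, `X ↦ tr (ρ G(X))` is a probability measure.
The values of `G` on non-measurable sets play no role. -/
def IsPOVM (G : Set Ω → (H →L[ℂ] H)) : Prop :=
  ∀ ρ : H →L[ℂ] H, IsDensityOperator ρ → ∃ μ : Measure Ω, IsOutcomeMeasure G ρ μ

/-- `T = ∫ f dG` (weakly): `tr (ρ T) = ∫ f(λ) d(tr (ρ G(λ)))` for all states `ρ`. -/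
def IsPOVMIntegral (G : Set Ω → (H →L[ℂ] H)) (f : Ω → ℂ) (T : H →L[ℂ] H) : Prop :=
  ∀ (ρ : H →L[ℂ] H) (μ : Measure Ω), IsDensityOperator ρ → IsOutcomeMeasure G ρ μ →
    Integrable f μ ∧ trace (ρ * T) = ∫ l, f l ∂μ

/-- `Λ(A) = ∫ tr (σ_λ A) dG(λ)` is the Heisenberg picture entanglement breaking channel given by
the POVM `G` and the weakly measurable family of states `σ`. -/
structure IsEBChannel (G : Set Ω → (H →L[ℂ] H)) (σ : Ω → (H →L[ℂ] H))
    (Λ : (H →L[ℂ] H) →ₗ[ℂ] (H →L[ℂ] H)) : Prop where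
  isPOVM : IsPOVM G
  isState : ∀ l, IsDensityOperator (σ l)
  measurable : ∀ A : H →L[ℂ] H, Measurable (fun l => trace (σ l * A))
  eq_integral : ∀ A : H →L[ℂ] H, IsPOVMIntegral G (fun l => trace (σ l * A)) (Λ A)

end EB

end QChannel

end

/-!
# Fixed points of symmetric and of entanglement breaking channels

**Algebra.** Let `Φ` be a symmetric channel with marginal `Λ`, and let `ψ` be a completely positive
idempotent onto `Fix Λ` with `ψ ∘ Λ = ψ`. By Choi and Effros, `ψ (A B)` is an associative product
which makes `Fix Λ` a C⋆-algebra (`IsProjectionOnto.commCStarAlgebra`). The point is that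
`ψ (Φ (A ⊗ B)) = ψ (A B)` for fixed points `A`, `B` (`map_opTensor_eq_map_mul`). Indeed
`Φ ((A ⊗ 1)⋆ (A ⊗ 1)) = Λ (A⋆ A)` has the same image under `ψ` as `Λ(A)⋆ Λ(A) = A⋆ A`, so the
Kadison–Schwarz inequality for `Φ` at `A ⊗ 1` becomes an equality after applying `ψ`, and by the
multiplicative domain argument (`linearMap_map_star_mul_of_saturated`) `ψ (Φ ((A ⊗ 1)⋆ Y))` is
`ψ (Λ(A)⋆ Φ(Y))` for every `Y`. Since `Φ` is symmetric, the product is commutative.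

**Predual and projection.** `Λ` is ultraweakly continuous, because `Φ` is normal and `A ↦ A ⊗ 1`
pulls matrix elements on `H ⊗ H` back to norm limits of combinations of matrix elements on `H`
(`tensorFunctional_mem`). So `Fix Λ` is ultraweakly closed and is the dual of the normal functionals
restricted to it (`exists_predual_fixedPoints`). A limit of the Cesàro means of `Λ` along an
ultrafilter exists by
compactness of bounded sets of operators, and has the required properties by normality of `Λ`
(`exists_fixedPointProjection_marginal`).

**Entanglement breaking channels.** Preparing `σ_λ ⊗ σ_λ` on the outcome `λ` of the POVM gives a
symmetric channel with marginal `Λ` (`IsEBChannel.exists_symmetric`), so the first two parts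
apply. Three facts enter: bounded measurable functions have POVM integrals, which depend on the
function in a completely positive way (`IsPOVM.exists_integral`,
`IsPOVM.sum_inner_integral_nonneg`); `λ ↦ tr ((σ_λ ⊗ σ_λ) C)` is measurable, as one sees in a
countable product basis (`measurable_trace_opTensor_mul`); and the channel is normal, since the
mixture `∫ σ_λ ⊗ σ_λ dμ(λ)` is a trace-class operator for every outcome distribution `μ`
(`exists_mixture`).
-/

noncomputable section

namespace QChannel

universe u w

/-! ### Nuclear representations and the trace -/

section Nuclear

variable {H : Type u} [NormedAddCommGroup H] [InnerProductSpace ℂ H]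
variable {ι : Type*} {x y : ι → H} {T S : H →L[ℂ] H}

/-- `T = ∑ᵢ |yᵢ⟩⟨xᵢ|` with both families square-summable, over an arbitrary index type. Balancing
the norms of `xᵢ` and `yᵢ` brings every trace-class operator into this form. -/
structure NuclearRep (x y : ι → H) (T : H →L[ℂ] H) : Prop where
  left : Summable fun i => ‖x i‖ ^ 2
  right : Summable fun i => ‖y i‖ ^ 2
  hasSum : ∀ v, HasSum (fun i => inner ℂ (x i) v • y i) (T v)

theorem norm_mul_norm_le {E : Type*} [NormedAddCommGroup E] (a b : E) :
    ‖a‖ * ‖b‖ ≤ ‖a‖ ^ 2 + ‖b‖ ^ 2 := by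
  nlinarith [sq_nonneg (‖a‖ - ‖b‖), sq_nonneg ‖a‖, sq_nonneg ‖b‖]

theorem NuclearRep.summable_mul (h : NuclearRep x y T) : Summable fun i => ‖x i‖ * ‖y i‖ :=
  (h.left.add h.right).of_nonneg_of_le (fun _ => by positivity)
    (fun i => norm_mul_norm_le (x i) (y i))

theorem NuclearRep.summable_inner_map (h : NuclearRep x y T) (A : H →L[ℂ] H) :
    Summable fun i => inner ℂ (x i) (A (y i)) := by
  refine (h.summable_mul.mul_left ‖A‖).of_norm_bounded fun i => ?_
  calc ‖inner ℂ (x i) (A (y i))‖ ≤ ‖x i‖ * ‖A (y i)‖ := norm_inner_le_norm _ _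
    _ ≤ ‖x i‖ * (‖A‖ * ‖y i‖) := by gcongr; exact A.le_opNorm _
    _ = ‖A‖ * (‖x i‖ * ‖y i‖) := by ring

theorem IsTraceClass.exists_nuclearRep (hT : IsTraceClass T) :
    ∃ x y : ℕ → H, NuclearRep x y T := by
  obtain ⟨x, y, hs, hT⟩ := hT
  set t : ℕ → ℝ := fun n => Real.sqrt (‖y n‖ / ‖x n‖) with ht
  have key : ∀ n, (x n ≠ 0 ∧ y n ≠ 0) → 0 < t n := fun n hn =>
    Real.sqrt_pos.2 (div_pos (norm_pos_iff.2 hn.2) (norm_pos_iff.2 hn.1))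
  -- rescaling `x n` by `t` and `y n` by `t⁻¹` makes both norms equal to `√(‖x n‖ ‖y n‖)`;
  -- terms with a vanishing factor have `t n = 0` and are replaced by zero
  have h1 : ∀ n, ‖(t n : ℂ) • x n‖ ^ 2 = ‖x n‖ * ‖y n‖ := fun n => by
    rw [norm_smul, mul_pow, Complex.norm_real, Real.norm_eq_abs, sq_abs,
      Real.sq_sqrt (by positivity)]
    rcases eq_or_ne (x n) 0 with h | h
    · simp [h]
    · have := norm_ne_zero_iff.2 h
      field_simp
  have h2 : ∀ n, ‖((t n)⁻¹ : ℂ) • y n‖ ^ 2 = ‖x n‖ * ‖y n‖ := fun n => by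
    rw [norm_smul, mul_pow, norm_inv, inv_pow, Complex.norm_real, Real.norm_eq_abs, sq_abs,
      Real.sq_sqrt (by positivity)]
    rcases eq_or_ne (y n) 0 with h | h
    · simp [h]
    · have := norm_ne_zero_iff.2 h
      rcases eq_or_ne (x n) 0 with h' | h'
      · simp [h']
      · have := norm_ne_zero_iff.2 h'
        field_simp
  refine ⟨fun n => (t n : ℂ) • x n, fun n => ((t n)⁻¹ : ℂ) • y n, ?_, ?_, fun v => ?_⟩
  · simpa only [h1] using hs
  · simpa only [h2] using hs
  · convert hT v using 2 with n
    rw [inner_smul_left, Complex.conj_ofReal, smul_smul]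
    rcases eq_or_ne (x n) 0 with h | h
    · simp [h]
    rcases eq_or_ne (y n) 0 with h' | h'
    · simp [h']
    have := (key n ⟨h, h'⟩).ne'
    congr 1
    have : (t n : ℂ) ≠ 0 := by exact_mod_cast this
    field_simp

theorem NuclearRep.isTraceClass [Countable ι] (h : NuclearRep x y T) : IsTraceClass T := by
  obtain ⟨f, hf⟩ := exists_injective_nat ι
  refine ⟨Function.extend f x 0, Function.extend f y 0, ?_, fun v => ?_⟩
  · rw [← hf.summable_iff]
    · simpa [Function.comp_def, hf.extend_apply] using h.summable_mul
    · intro n hn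
      rw [Function.extend_apply' _ _ _ (by simpa using hn)]; simp
  · rw [← hf.hasSum_iff]
    · simpa [Function.comp_def, hf.extend_apply] using h.hasSum v
    · intro n hn
      rw [Function.extend_apply' _ _ _ (by simpa using hn)]; simp

theorem IsTraceClass.smul (hT : IsTraceClass T) (c : ℂ) : IsTraceClass (c • T) := by
  obtain ⟨x, y, hs, hT⟩ := hT
  refine ⟨x, fun n => c • y n, ?_, fun v => ?_⟩
  · refine (hs.mul_left ‖c‖).congr fun n => ?_
    rw [norm_smul]; ring
  · change HasSum _ (c • T v)
    simpa only [smul_comm c] using (hT v).const_smul c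

theorem isTraceClass_zero : IsTraceClass (0 : H →L[ℂ] H) :=
  ⟨0, 0, by simp, fun v => by simp⟩

theorem IsTraceClass.add (hT : IsTraceClass T) (hS : IsTraceClass S) : IsTraceClass (T + S) := by
  obtain ⟨x, y, hT⟩ := hT.exists_nuclearRep
  obtain ⟨x', y', hS⟩ := hS.exists_nuclearRep
  have : NuclearRep (Sum.elim x x') (Sum.elim y y') (T + S) := by
    refine ⟨?_, ?_, fun v => ?_⟩
    · exact (HasSum.sum (f := fun i => ‖Sum.elim x x' i‖ ^ 2) hT.left.hasSum
        hS.left.hasSum).summable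
    · exact (HasSum.sum (f := fun i => ‖Sum.elim y y' i‖ ^ 2) hT.right.hasSum
        hS.right.hasSum).summable
    · exact HasSum.sum (f := fun i => inner ℂ (Sum.elim x x' i) v • Sum.elim y y' i)
        (hT.hasSum v) (hS.hasSum v)
  exact this.isTraceClass

theorem IsTraceClass.sum {κ : Type*} (s : Finset κ) {T : κ → H →L[ℂ] H}
    (h : ∀ k ∈ s, IsTraceClass (T k)) : IsTraceClass (∑ k ∈ s, T k) := by
  classical
  induction s using Finset.induction_on with
  | empty => simpa using isTraceClass_zero
  | insert a s ha ih =>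
    rw [Finset.sum_insert ha]
    exact (h a (by simp)).add (ih fun k hk => h k (by simp [hk]))

theorem nuclearRep_rankOne (a b : H) :
    NuclearRep (fun _ : Unit => b) (fun _ => a) (InnerProductSpace.rankOne ℂ a b) :=
  ⟨(hasSum_fintype _).summable, (hasSum_fintype _).summable, fun v => by simp⟩

theorem isTraceClass_rankOne (a b : H) : IsTraceClass (InnerProductSpace.rankOne ℂ a b) :=
  (nuclearRep_rankOne a b).isTraceClass

theorem NuclearRep.comp_left (h : NuclearRep x y T) (A : H →L[ℂ] H) :
    NuclearRep x (fun i => A (y i)) (A * T) := by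
  refine ⟨h.left, ?_, fun v => ?_⟩
  · refine (h.right.mul_left (‖A‖ ^ 2)).of_nonneg_of_le (fun _ => by positivity) fun i => ?_
    rw [← mul_pow]
    gcongr
    exact A.le_opNorm _
  · simpa using (h.hasSum v).mapL A

theorem _root_.HilbertBasis.hasSum_norm_inner_sq {κ : Type*} (b : HilbertBasis κ ℂ H) (v : H) :
    HasSum (fun k => ‖inner ℂ (b k) v‖ ^ 2) (‖v‖ ^ 2) := by
  have := (b.hasSum_inner_mul_inner v v).mapL Complex.reCLM
  simp only [Complex.reCLM_apply] at this
  convert this using 2 with k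
  · rw [← inner_conj_symm v (b k), ← Complex.normSq_eq_conj_mul_self, Complex.ofReal_re,
      Complex.normSq_eq_norm_sq]
  · simpa using (inner_self_eq_norm_sq (𝕜 := ℂ) v).symm

theorem IsTraceClass.mul_left (hT : IsTraceClass T) (A : H →L[ℂ] H) : IsTraceClass (A * T) := by
  obtain ⟨x, y, h⟩ := hT.exists_nuclearRep
  exact (h.comp_left A).isTraceClass

/-- The diagonal of a nuclear operator along any Hilbert basis sums to `∑ᵢ ⟨xᵢ, yᵢ⟩`. -/
theorem NuclearRep.hasSum_diag (h : NuclearRep x y T) {κ : Type*} (b : HilbertBasis κ ℂ H) :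
    HasSum (fun k => inner ℂ (b k) (T (b k))) (∑' i, inner ℂ (x i) (y i)) := by
  set f : ι × κ → ℂ := fun p => inner ℂ (x p.1) (b p.2) * inner ℂ (b p.2) (y p.1) with hf
  have hsum : Summable f := by
    have hg : Summable fun p : ι × κ =>
        ‖inner ℂ (b p.2) (x p.1)‖ ^ 2 + ‖inner ℂ (b p.2) (y p.1)‖ ^ 2 := by
      rw [summable_prod_of_nonneg (fun p => by positivity)]
      refine ⟨fun i => ((b.hasSum_norm_inner_sq (x i)).add
        (b.hasSum_norm_inner_sq (y i))).summable, ?_⟩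
      refine (h.left.add h.right).congr fun i => ?_
      exact ((b.hasSum_norm_inner_sq (x i)).add (b.hasSum_norm_inner_sq (y i))).tsum_eq.symm
    refine hg.of_norm_bounded fun p => ?_
    rw [hf, norm_mul, norm_inner_symm]
    exact norm_mul_norm_le _ _
  have h1 : HasSum f (∑' i, inner ℂ (x i) (y i)) := by
    have := hsum.hasSum.prod_fiberwise (fun i => b.hasSum_inner_mul_inner (x i) (y i))
    rw [this.tsum_eq]
    exact hsum.hasSum
  refine ((Equiv.prodComm κ ι).hasSum_iff.2 h1).prod_fiberwise fun k => ?_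
  have := (h.hasSum (b k)).mapL (innerSL ℂ (b k))
  simpa [hf, inner_smul_right] using this

variable [CompleteSpace H]

theorem NuclearRep.comp_right (h : NuclearRep x y T) (A : H →L[ℂ] H) :
    NuclearRep (fun i => (star A) (x i)) y (T * A) := by
  refine ⟨?_, h.right, fun v => ?_⟩
  · refine (h.left.mul_left (‖star A‖ ^ 2)).of_nonneg_of_le (fun _ => by positivity) fun i => ?_
    rw [← mul_pow]
    gcongr
    exact (star A).le_opNorm _
  · simpa [ContinuousLinearMap.star_eq_adjoint, ContinuousLinearMap.adjoint_inner_left] using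
      h.hasSum (A v)

theorem IsTraceClass.mul_right (hT : IsTraceClass T) (A : H →L[ℂ] H) : IsTraceClass (T * A) := by
  obtain ⟨x, y, h⟩ := hT.exists_nuclearRep
  exact (h.comp_right A).isTraceClass

theorem NuclearRep.trace_eq (h : NuclearRep x y T) : trace T = ∑' i, inner ℂ (x i) (y i) :=
  (h.hasSum_diag _).tsum_eq

theorem IsTraceClass.hasSum_diag (hT : IsTraceClass T) {κ : Type*} (b : HilbertBasis κ ℂ H) :
    HasSum (fun k => inner ℂ (b k) (T (b k))) (trace T) := by
  obtain ⟨x, y, h⟩ := hT.exists_nuclearRep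
  rw [h.trace_eq]
  exact h.hasSum_diag b

theorem NuclearRep.hasSum_trace_mul (h : NuclearRep x y T) (A : H →L[ℂ] H) :
    HasSum (fun i => inner ℂ (x i) (A (y i))) (trace (T * A)) := by
  have := (h.comp_right A).trace_eq
  simp only [ContinuousLinearMap.star_eq_adjoint, ContinuousLinearMap.adjoint_inner_left] at this
  rw [this]
  exact (h.summable_inner_map A).hasSum

theorem trace_mul_comm (hT : IsTraceClass T) (A : H →L[ℂ] H) : trace (A * T) = trace (T * A) := by
  obtain ⟨x, y, h⟩ := hT.exists_nuclearRep
  rw [(h.comp_left A).trace_eq, (h.hasSum_trace_mul A).tsum_eq]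

theorem trace_rankOne_mul (a b : H) (A : H →L[ℂ] H) :
    trace (InnerProductSpace.rankOne ℂ a b * A) = inner ℂ b (A a) := by
  rw [← ((nuclearRep_rankOne a b).hasSum_trace_mul A).tsum_eq]
  simp

theorem trace_mul_add (hT : IsTraceClass T) (A B : H →L[ℂ] H) :
    trace (T * (A + B)) = trace (T * A) + trace (T * B) := by
  obtain ⟨x, y, h⟩ := hT.exists_nuclearRep
  refine (h.hasSum_trace_mul _).unique ?_
  simpa [inner_add_right] using (h.hasSum_trace_mul A).add (h.hasSum_trace_mul B)

theorem trace_mul_smul (hT : IsTraceClass T) (c : ℂ) (A : H →L[ℂ] H) :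
    trace (T * (c • A)) = c * trace (T * A) := by
  obtain ⟨x, y, h⟩ := hT.exists_nuclearRep
  refine (h.hasSum_trace_mul _).unique ?_
  simpa [inner_smul_right] using (h.hasSum_trace_mul A).mul_left c

theorem trace_add (hT : IsTraceClass T) (hS : IsTraceClass S) :
    trace (T + S) = trace T + trace S := by
  have hb := (exists_hilbertBasis ℂ H).choose_spec.choose
  refine ((hT.add hS).hasSum_diag hb).unique ?_
  simpa [inner_add_right] using (hT.hasSum_diag hb).add (hS.hasSum_diag hb)

theorem trace_smul (c : ℂ) (hT : IsTraceClass T) : trace (c • T) = c * trace T := by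
  have hb := (exists_hilbertBasis ℂ H).choose_spec.choose
  refine ((hT.smul c).hasSum_diag hb).unique ?_
  simpa [inner_smul_right] using (hT.hasSum_diag hb).mul_left c

/-- The functional `A ↦ tr (T A)` of a trace-class operator `T`. -/
def traceMul (hT : IsTraceClass T) : (H →L[ℂ] H) →ₗ[ℂ] ℂ where
  toFun A := trace (T * A)
  map_add' := trace_mul_add hT
  map_smul' c A := by rw [trace_mul_smul hT, smul_eq_mul, RingHom.id_apply]

@[simp] theorem traceMul_apply (hT : IsTraceClass T) (A : H →L[ℂ] H) :
    traceMul hT A = trace (T * A) := rfl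

/-- Along bounded families, convergence of matrix elements implies convergence of the
functionals `A ↦ tr (T A)`: on bounded sets the weak and ultraweak topologies agree. -/
theorem tendsto_trace_mul {α : Type*} {F : Filter α} {A : α → H →L[ℂ] H} {B : H →L[ℂ] H} {C : ℝ}
    (hC : ∀ n, ‖A n‖ ≤ C)
    (hA : ∀ u v, Tendsto (fun n => inner ℂ u (A n v)) F (𝓝 (inner ℂ u (B v))))
    (hT : IsTraceClass T) :
    Tendsto (fun n => trace (T * A n)) F (𝓝 (trace (T * B))) := by
  obtain ⟨x, y, h⟩ := hT.exists_nuclearRep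
  simp only [← (h.hasSum_trace_mul _).tsum_eq]
  refine tendsto_tsum_of_dominated_convergence (h.summable_mul.mul_left C) (fun k => hA _ _)
    (.of_forall fun n i => ?_)
  calc ‖inner ℂ (x i) (A n (y i))‖ ≤ ‖x i‖ * ‖A n (y i)‖ := norm_inner_le_norm _ _
    _ ≤ ‖x i‖ * (C * ‖y i‖) := by gcongr; exact (A n).le_of_opNorm_le (hC n) _
    _ = C * (‖x i‖ * ‖y i‖) := by ring

end Nuclear

/-! ### Positivity of operator matrices -/

section OperatorMatrix

open scoped ComplexOrder

variable {H : Type u} [NormedAddCommGroup H] [InnerProductSpace ℂ H]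

theorem isPositive_of_inner_nonneg {T : H →L[ℂ] H} (h : ∀ v, 0 ≤ inner ℂ v (T v)) :
    T.IsPositive := by
  rw [ContinuousLinearMap.isPositive_iff_complex]
  intro v
  have hv := h v
  rw [← inner_conj_symm] at hv
  have hv' : 0 ≤ inner ℂ (T v) v := by simpa using star_nonneg_iff.1 hv
  rw [Complex.le_def] at hv'
  refine ⟨?_, by simpa using hv'.1⟩
  apply Complex.ext <;> simp
  simpa using hv'.2

theorem inner_self_nonneg_complex (v : H) : (0 : ℂ) ≤ inner ℂ v v := by
  rw [inner_self_eq_norm_sq_to_K]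
  exact Complex.zero_le_real.2 (sq_nonneg ‖v‖) |>.trans_eq (by simp)

theorem inner_star_right [CompleteSpace H] (A : H →L[ℂ] H) (u v : H) :
    inner ℂ u (star A v) = inner ℂ (A u) v :=
  ContinuousLinearMap.adjoint_inner_right A u v

theorem inner_star_left [CompleteSpace H] (A : H →L[ℂ] H) (u v : H) :
    inner ℂ (star A u) v = inner ℂ u (A v) :=
  ContinuousLinearMap.adjoint_inner_left A v u

theorem nonneg_iff_exists_star_mul_self {A : Type*} [NonUnitalCStarAlgebra A] [PartialOrder A]
    [StarOrderedRing A] {a : A} : 0 ≤ a ↔ ∃ b, a = star b * b :=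
  CStarAlgebra.nonneg_iff_eq_star_mul_self

theorem isPositive_iff_exists_star_mul_self [CompleteSpace H] {T : H →L[ℂ] H} :
    T.IsPositive ↔ ∃ S : H →L[ℂ] H, T = star S * S := by
  rw [← ContinuousLinearMap.nonneg_iff_isPositive]
  exact nonneg_iff_exists_star_mul_self

variable [CompleteSpace H] {n : Type*} [Fintype n]

/-- An operator matrix `(Mᵢⱼ)` is positive exactly when `∑ᵢⱼ ⟨xᵢ, Mᵢⱼ xⱼ⟩ ≥ 0` for all vectors:
it is then the matrix of a positive operator on the Hilbert sum of copies of `H`, and a square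
root of that operator has a matrix too. -/
theorem cstarMatrix_nonneg_iff {M : CStarMatrix n n (H →L[ℂ] H)} :
    0 ≤ M ↔ ∀ x : n → H, 0 ≤ ∑ i, ∑ j, inner ℂ (x i) (M i j (x j)) := by
  classical
  constructor
  · intro hM x
    obtain ⟨N, rfl⟩ := nonneg_iff_exists_star_mul_self.1 hM
    have : ∑ i, ∑ j, inner ℂ (x i) ((star N * N) i j (x j)) =
        ∑ l, inner ℂ (∑ i, N l i (x i)) (∑ j, N l j (x j)) := by
      simp only [CStarMatrix.mul_apply, CStarMatrix.star_apply, sum_inner, inner_sum,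
        _root_.sum_apply, mul_apply_eq_comp, inner_star_right]
      exact Finset.sum_comm.trans Finset.sum_comm_cycle
    rw [this]
    exact Finset.sum_nonneg fun l _ => inner_self_nonneg_complex _
  · intro hM
    set p : n → PiLp 2 (fun _ : n => H) →L[ℂ] H := fun i => PiLp.proj 2 _ i
    set e : n → H →L[ℂ] PiLp 2 (fun _ : n => H) := fun i =>
      ((PiLp.continuousLinearEquiv 2 ℂ (fun _ : n => H)).symm :
        (n → H) →L[ℂ] PiLp 2 (fun _ : n => H)) ∘L ContinuousLinearMap.single ℂ (fun _ : n => H) i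
    have pe : ∀ i j v, p i (e j v) = if i = j then v else 0 := fun i j v => by
      by_cases h : i = j
      · subst h; simp [p, e]
      · simp [p, e, h]
    set P : PiLp 2 (fun _ : n => H) →L[ℂ] PiLp 2 (fun _ : n => H) :=
      ∑ i, ∑ j, e i ∘L M i j ∘L p j with hP
    have inner_e : ∀ i u w, inner ℂ w (e i u) = inner ℂ (p i w) u := fun i u w => by
      rw [PiLp.inner_apply]
      rw [Finset.sum_eq_single i]
      · change inner ℂ (p i w) (p i (e i u)) = _
        rw [pe, if_pos rfl]
      · intro j _ hj
        change inner ℂ (p j w) (p j (e i u)) = _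
        rw [pe, if_neg hj, inner_zero_right]
      · simp
    have hPpos : P.IsPositive := isPositive_of_inner_nonneg fun w => by
      have : inner ℂ w (P w) = ∑ i, ∑ j, inner ℂ (p i w) (M i j (p j w)) := by
        simp [hP, _root_.sum_apply, inner_e]
      rw [this]
      exact hM fun i => p i w
    obtain ⟨S, hS⟩ := isPositive_iff_exists_star_mul_self.1 hPpos
    refine nonneg_iff_exists_star_mul_self.2
      ⟨CStarMatrix.ofMatrix fun i j => p i ∘L S ∘L e j, ?_⟩
    ext i j : 1
    ext v
    refine ext_inner_left ℂ fun u => ?_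
    have h1 : inner ℂ (e i u) (P (e j v)) = inner ℂ u (M i j v) := by
      simp only [hP, _root_.sum_apply, inner_sum, inner_e, pe,
        ContinuousLinearMap.comp_apply]
      rw [Finset.sum_eq_single i, Finset.sum_eq_single j]
      · simp
      · intro b _ hb; simp [hb]
      · simp
      · intro b _ hb; simp [hb]
      · simp
    rw [← h1, hS]
    simp only [CStarMatrix.mul_apply, CStarMatrix.star_apply, inner_sum,
      _root_.sum_apply, mul_apply_eq_comp, inner_star_right]
    rw [PiLp.inner_apply]
    rfl

variable {K : Type*} [NormedAddCommGroup K] [InnerProductSpace ℂ K] [CompleteSpace K]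

theorem sum_inner_map_nonneg (Φ : (K →L[ℂ] K) →CP (H →L[ℂ] H)) {M : n → n → K →L[ℂ] K}
    (hM : ∀ x : n → K, 0 ≤ ∑ i, ∑ j, inner ℂ (x i) (M i j (x j))) (x : n → H) :
    0 ≤ ∑ i, ∑ j, inner ℂ (x i) (Φ (M i j) (x j)) :=
  cstarMatrix_nonneg_iff.1
    (Φ.map_cstarMatrix_nonneg (CStarMatrix.ofMatrix M) (cstarMatrix_nonneg_iff.2 hM)) x

/-- A completely positive map from a linear map preserving positivity of the sesquilinear forms
of operator matrices. -/
def cpOfForm (φ : (K →L[ℂ] K) →ₗ[ℂ] (H →L[ℂ] H))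
    (hφ : ∀ (k : ℕ) (M : Fin k → Fin k → K →L[ℂ] K),
      (∀ x : Fin k → K, 0 ≤ ∑ i, ∑ j, inner ℂ (x i) (M i j (x j))) →
      ∀ x : Fin k → H, 0 ≤ ∑ i, ∑ j, inner ℂ (x i) (φ (M i j) (x j))) :
    (K →L[ℂ] K) →CP (H →L[ℂ] H) where
  toLinearMap := φ
  map_cstarMatrix_nonneg' k M hM :=
    cstarMatrix_nonneg_iff.2 (hφ k (fun i j => M i j) (cstarMatrix_nonneg_iff.1 hM))

end OperatorMatrix

/-! ### The Schwarz inequality and multiplicative domains -/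

section Schwarz

open scoped ComplexOrder

variable {H : Type u} [NormedAddCommGroup H] [InnerProductSpace ℂ H] [CompleteSpace H]
variable {K : Type*} [NormedAddCommGroup K] [InnerProductSpace ℂ K] [CompleteSpace K]

/-- The Kadison–Schwarz inequality, from positivity of the image of the matrix
`[[1, X], [X*, X* X]]`. -/
theorem star_mul_self_map_le (Φ : (K →L[ℂ] K) →CP (H →L[ℂ] H)) (h1 : Φ 1 = 1) (X : K →L[ℂ] K) :
    star (Φ X) * Φ X ≤ Φ (star X * X) := by
  have h := sum_inner_map_nonneg Φ (n := Fin 2)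
    (M := fun i j => star ((![1, X] : Fin 2 → K →L[ℂ] K) i) * (![1, X] : Fin 2 → K →L[ℂ] K) j)
    (fun x => by
      have := inner_self_nonneg_complex (x 0 + X (x 1))
      simpa only [Fin.sum_univ_two, Matrix.cons_val_zero, Matrix.cons_val_one, star_one, one_mul,
        mul_one, mul_apply_eq_comp, inner_star_right, inner_add_left, inner_add_right,
        one_apply_eq_self, add_assoc, add_left_comm] using this)
  rw [ContinuousLinearMap.le_def]
  refine isPositive_of_inner_nonneg fun v => ?_
  have := h ![-(Φ X v), v]
  simp only [Fin.sum_univ_two, Matrix.cons_val_zero, Matrix.cons_val_one, star_one, one_mul,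
    mul_one, h1, map_star] at this
  rw [_root_.sub_apply, inner_sub_right, mul_apply_eq_comp, inner_star_right]
  simpa only [inner_star_right, inner_neg_left, inner_neg_right, neg_neg, map_neg,
    one_apply_eq_self, add_neg_cancel, zero_add, neg_add_eq_sub] using this

theorem norm_map_le (Φ : (K →L[ℂ] K) →CP (H →L[ℂ] H)) (h1 : Φ 1 = 1) (X : K →L[ℂ] K) :
    ‖Φ X‖ ≤ ‖X‖ := by
  have h2 : ‖Φ (star X * X)‖ ≤ ‖Φ 1‖ * ‖star X * X‖ :=
    PositiveLinearMap.norm_apply_le_of_nonneg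
      (PositiveLinearMap.ofClass Φ) _ (star_mul_self_nonneg X)
  have h3 : ‖star (Φ X) * Φ X‖ ≤ ‖Φ (star X * X)‖ :=
    CStarAlgebra.norm_le_norm_of_nonneg_of_le (star_mul_self_nonneg _)
      (star_mul_self_map_le Φ h1 X)
  rw [CStarRing.norm_star_mul_self] at h2 h3
  have h4 : ‖Φ 1‖ ≤ 1 := by rw [h1]; exact ContinuousLinearMap.norm_id_le
  have : ‖Φ X‖ * ‖Φ X‖ ≤ ‖X‖ * ‖X‖ := by nlinarith [norm_nonneg X, mul_self_nonneg ‖X‖]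
  exact abs_le_of_sq_le_sq' (by nlinarith) (norm_nonneg _) |>.2

theorem cp_map_star (Φ : (K →L[ℂ] K) →CP (H →L[ℂ] H)) (X : K →L[ℂ] K) :
    Φ (star X) = star (Φ X) :=
  map_star Φ X

theorem eq_zero_of_forall_nonneg_add_mul {a q p : ℂ}
    (h : ∀ c : ℂ, 0 ≤ a + (c * q + star c * p)) : p = 0 := by
  have key : ∀ r : ℂ, (∀ t : ℝ, 0 ≤ a + t * r) → r = 0 := fun r hr => by
    have hlin : ∀ α β : ℝ, (∀ t : ℝ, 0 ≤ α + t * β) → β = 0 := fun α β hab => by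
      by_contra hβ
      have := hab (-(α + 1) / β)
      rw [div_mul_cancel₀ _ hβ] at this
      linarith
    have h0 := (Complex.le_def.1 (hr 0)).2
    have h1 := (Complex.le_def.1 (hr 1)).2
    simp at h0 h1
    refine Complex.ext (hlin a.re r.re fun t => ?_) ?_
    · simpa using (Complex.le_def.1 (hr t)).1
    · simpa [← h0] using h1.symm
  have h1 := key (q + p) fun t => by simpa [mul_add] using h t
  have h2 := key (Complex.I * (q - p)) fun t => by
    have := h (t * Complex.I)
    simp only [star_mul', Complex.star_def, Complex.conj_I, Complex.conj_ofReal] at this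
    convert this using 2
    ring
  have h3 : q - p = 0 := by simpa using h2
  linear_combination (h1 - h3) / 2

/-- If the Schwarz inequality for `E` at `A` is saturated after applying a positive map `ψ`, then
`A` is in the multiplicative domain of `E` modulo the kernel of `ψ`: the positive semidefinite
form `(X, Y) ↦ ψ (E (X* Y) - E(X)* E(Y))` has `A` as a null vector, so `A` is in its kernel. -/
theorem linearMap_map_star_mul_of_saturated (E : (K →L[ℂ] K) →ₗ[ℂ] (H →L[ℂ] H))
    (hE : ∀ X, star (E X) * E X ≤ E (star X * X)) (ψ : (H →L[ℂ] H) →ₗ[ℂ] (H →L[ℂ] H))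
    (hψ : ∀ X, 0 ≤ X → 0 ≤ ψ X) {A : K →L[ℂ] K}
    (hA : ψ (E (star A * A)) = ψ (star (E A) * E A)) (Y : K →L[ℂ] K) :
    ψ (E (star A * Y)) = ψ (star (E A) * E Y) := by
  set D : (K →L[ℂ] K) → (K →L[ℂ] K) → (H →L[ℂ] H) := fun X Y =>
    ψ (E (star X * Y)) - ψ (star (E X) * E Y) with hD
  have hpos : ∀ Z, 0 ≤ D Z Z := fun Z => by
    rw [hD]; simp only
    rw [← map_sub]
    exact hψ _ (sub_nonneg.2 (hE Z))
  have hDA : D A A = 0 := sub_eq_zero.2 hA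
  have hexp : ∀ c : ℂ, D (Y + c • A) (Y + c • A) = D Y Y + (c • D Y A + star c • D A Y) := by
    intro c
    have : D (Y + c • A) (Y + c • A) =
        D Y Y + (c • D Y A + star c • D A Y) + (star c * c) • D A A := by
      simp only [hD, star_add, star_smul, map_add, map_smul, add_mul, mul_add, smul_mul_assoc,
        mul_smul_comm]
      module
    rw [this, hDA, smul_zero, add_zero]
  rw [← sub_eq_zero]
  change D A Y = 0
  have : ((D A Y : H →L[ℂ] H) : H →ₗ[ℂ] H) = 0 := by
    refine (inner_map_self_eq_zero _).1 fun v => ?_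
    rw [← inner_conj_symm, map_eq_zero]
    refine eq_zero_of_forall_nonneg_add_mul (a := inner ℂ v (D Y Y v)) (q := inner ℂ v (D Y A v))
      fun c => ?_
    have h := ((ContinuousLinearMap.nonneg_iff_isPositive _).1
      (hpos (Y + c • A))).inner_nonneg_right v
    rw [hexp] at h
    simpa [inner_add_right, inner_smul_right] using h
  exact ContinuousLinearMap.coe_inj.1 this

theorem map_star_mul_of_saturated (Φ : (K →L[ℂ] K) →CP (H →L[ℂ] H)) (h1 : Φ 1 = 1)
    (ψ : (H →L[ℂ] H) →CP (H →L[ℂ] H)) {A : K →L[ℂ] K}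
    (hA : ψ (Φ (star A * A)) = ψ (star (Φ A) * Φ A)) (Y : K →L[ℂ] K) :
    ψ (Φ (star A * Y)) = ψ (star (Φ A) * Φ Y) :=
  linearMap_map_star_mul_of_saturated (Φ : (K →L[ℂ] K) →ₗ[ℂ] (H →L[ℂ] H))
    (star_mul_self_map_le Φ h1) (ψ : (H →L[ℂ] H) →ₗ[ℂ] (H →L[ℂ] H))
    (fun _ hX => map_nonneg ψ hX) hA Y

end Schwarz

/-! ### The Choi–Effros product -/

section ChoiEffros

variable {H : Type u} [NormedAddCommGroup H] [InnerProductSpace ℂ H] [CompleteSpace H]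

/-- `ψ` is an idempotent with range `V`, and `V` contains the identity operator. -/
structure IsProjectionOnto (V : Submodule ℂ (H →L[ℂ] H)) (ψ : (H →L[ℂ] H) →CP (H →L[ℂ] H)) :
    Prop where
  idempotent : ∀ A, ψ (ψ A) = ψ A
  range_eq : Set.range ψ = V
  one_mem : (1 : H →L[ℂ] H) ∈ V

namespace IsProjectionOnto

variable {V : Submodule ℂ (H →L[ℂ] H)} {ψ : (H →L[ℂ] H) →CP (H →L[ℂ] H)}

theorem apply_mem (h : IsProjectionOnto V ψ) (A : H →L[ℂ] H) : ψ A ∈ V := by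
  rw [← SetLike.mem_coe, ← h.range_eq]
  exact ⟨A, rfl⟩

theorem apply_of_mem (h : IsProjectionOnto V ψ) {A : H →L[ℂ] H} (hA : A ∈ V) : ψ A = A := by
  rw [← SetLike.mem_coe, ← h.range_eq] at hA
  obtain ⟨B, rfl⟩ := hA
  exact h.idempotent B

theorem star_mem (h : IsProjectionOnto V ψ) {A : H →L[ℂ] H} (hA : A ∈ V) : star A ∈ V := by
  have : ψ (star A) = star A := by rw [map_star, h.apply_of_mem hA]
  exact this ▸ h.apply_mem (star A)

theorem map_one (h : IsProjectionOnto V ψ) : ψ 1 = 1 := h.apply_of_mem h.one_mem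

/-- Fixed points `A` of `ψ` saturate its Schwarz inequality modulo the kernel of `ψ`, so `ψ` behaves
like a conditional expectation under multiplication by `A`. -/
theorem map_mul_map_right (h : IsProjectionOnto V ψ) {A : H →L[ℂ] H} (hA : A ∈ V)
    (Y : H →L[ℂ] H) : ψ (A * ψ Y) = ψ (A * Y) := by
  have := map_star_mul_of_saturated ψ h.map_one ψ (A := star A)
    (by rw [h.idempotent, h.apply_of_mem (h.star_mem hA)]) Y
  rw [star_star, h.idempotent, map_star, star_star, h.apply_of_mem hA] at this
  exact this.symm

theorem map_mul_map_left (h : IsProjectionOnto V ψ) {A : H →L[ℂ] H} (hA : A ∈ V)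
    (Y : H →L[ℂ] H) : ψ (ψ Y * A) = ψ (Y * A) := by
  have := h.map_mul_map_right (h.star_mem hA) (star Y)
  rw [map_star, ← star_mul, ← star_mul, map_star, map_star] at this
  exact star_injective this

/-- The Choi–Effros algebra: the range of a completely positive idempotent `ψ`, with the product
`(A, B) ↦ ψ (A B)`, assumed here to be commutative. The normed space structure is the one of the
subspace `V`. -/
@[reducible] def commCStarAlgebra (h : IsProjectionOnto V ψ) (hV : IsClosed (V : Set (H →L[ℂ] H)))
    (hcomm : ∀ A ∈ V, ∀ B ∈ V, ψ (A * B) = ψ (B * A)) : CommCStarAlgebra V :=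
  letI : CommRing V :=
    { (inferInstance : AddCommGroup V) with
      mul := fun A B => ⟨ψ (A * B), h.apply_mem _⟩
      one := ⟨1, h.one_mem⟩
      mul_assoc := fun A B C => Subtype.ext <| by
        change ψ (ψ (A * B) * C) = ψ (A * ψ (B * C))
        rw [h.map_mul_map_left C.2, h.map_mul_map_right A.2, mul_assoc]
      one_mul := fun A => Subtype.ext <| by
        change ψ (1 * A) = A
        rw [one_mul, h.apply_of_mem A.2]
      mul_one := fun A => Subtype.ext <| by
        change ψ (A * 1) = A
        rw [mul_one, h.apply_of_mem A.2]
      zero_mul := fun A => Subtype.ext <| by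
        change ψ (0 * A) = 0
        rw [zero_mul, map_zero]
      mul_zero := fun A => Subtype.ext <| by
        change ψ (A * 0) = 0
        rw [mul_zero, map_zero]
      left_distrib := fun A B C => Subtype.ext <| by
        change ψ (A * (B + C)) = ψ (A * B) + ψ (A * C)
        rw [mul_add, map_add]
      right_distrib := fun A B C => Subtype.ext <| by
        change ψ ((A + B) * C) = ψ (A * C) + ψ (B * C)
        rw [add_mul, map_add]
      mul_comm := fun A B => Subtype.ext (hcomm A A.2 B B.2) }
  letI : NormedCommRing V :=
    { (inferInstance : CommRing V), (inferInstance : NormedAddCommGroup V) with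
      norm_mul_le := fun A B =>
        (norm_map_le ψ h.map_one (A * B : H →L[ℂ] H)).trans (norm_mul_le _ _)
      mul_comm := mul_comm }
  letI : StarRing V :=
    { star := fun A => ⟨star (A : H →L[ℂ] H), h.star_mem A.2⟩
      star_involutive := fun A => Subtype.ext (star_star _)
      star_mul := fun A B => Subtype.ext <| by
        change star (ψ (A * B)) = ψ (star (B : H →L[ℂ] H) * star (A : H →L[ℂ] H))
        rw [← star_mul, map_star]
      star_add := fun A B => Subtype.ext (star_add _ _) }
  letI : NormedAlgebra ℂ V :=
    { Algebra.ofModule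
        (fun c A B => Subtype.ext <| by
          change ψ ((c • (A : H →L[ℂ] H)) * B) = c • ψ (A * B)
          rw [smul_mul_assoc, map_smul])
        (fun c A B => Subtype.ext <| by
          change ψ ((A : H →L[ℂ] H) * (c • (B : H →L[ℂ] H))) = c • ψ (A * B)
          rw [mul_smul_comm, map_smul]) with
      norm_smul_le := fun c A => norm_smul_le c A }
  { toNormedCommRing := inferInstance
    toStarRing := inferInstance
    toCompleteSpace := hV.completeSpace_coe
    toCStarRing := ⟨fun A => by
      change ‖(A : H →L[ℂ] H)‖ * ‖(A : H →L[ℂ] H)‖ ≤ ‖ψ (star (A : H →L[ℂ] H) * A)‖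
      rw [← CStarRing.norm_star_mul_self]
      refine CStarAlgebra.norm_le_norm_of_nonneg_of_le (star_mul_self_nonneg _) ?_
      simpa only [h.apply_of_mem A.2] using star_mul_self_map_le ψ h.map_one (A : H →L[ℂ] H)⟩
    toNormedAlgebra := inferInstance
    toStarModule := ⟨fun c A => Subtype.ext (star_smul c (A : H →L[ℂ] H))⟩ }

theorem isCommVonNeumannProduct (h : IsProjectionOnto V ψ) (hV : IsClosed (V : Set (H →L[ℂ] H)))
    (hcomm : ∀ A ∈ V, ∀ B ∈ V, ψ (A * B) = ψ (B * A))
    (hdual : ∃ (X : Type u) (_ : NormedAddCommGroup X) (_ : NormedSpace ℂ X) (_ : CompleteSpace X),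
      Nonempty (StrongDual ℂ X ≃ₗᵢ⋆[ℂ] V)) :
    IsCommVonNeumannProduct V fun A B => ψ ((A : H →L[ℂ] H) * B) :=
  ⟨V, h.commCStarAlgebra hV hcomm, LinearIsometryEquiv.refl ℂ V,
    letI := h.commCStarAlgebra hV hcomm
    { exists_predual := hdual }, rfl, fun _ => rfl, fun _ _ => rfl⟩

end IsProjectionOnto

end ChoiEffros

/-! ### Operators from matrix elements -/

section Sesquilinear

variable {H : Type u} [NormedAddCommGroup H] [InnerProductSpace ℂ H]

theorem norm_inner_self_complex (v : H) : ‖(inner ℂ v v : ℂ)‖ = ‖v‖ * ‖v‖ := by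
  rw [inner_self_eq_norm_sq_to_K]
  simp [sq]

theorem ext_inner_operator {A B : H →L[ℂ] H} (h : ∀ x y, inner ℂ x (A y) = inner ℂ x (B y)) :
    A = B :=
  ContinuousLinearMap.ext fun y => ext_inner_left ℂ fun x => h x y

variable [CompleteSpace H]

theorem exists_operator_of_sesquilinear (s : H → H → ℂ) (C : ℝ) (hC : 0 ≤ C)
    (add_left : ∀ x x' y, s (x + x') y = s x y + s x' y)
    (smul_left : ∀ (c : ℂ) x y, s (c • x) y = star c * s x y)
    (add_right : ∀ x y y', s x (y + y') = s x y + s x y')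
    (smul_right : ∀ (c : ℂ) x y, s x (c • y) = c * s x y)
    (bound : ∀ x y, ‖s x y‖ ≤ C * ‖x‖ * ‖y‖) :
    ∃ B : H →L[ℂ] H, ‖B‖ ≤ C ∧ ∀ x y, inner ℂ x (B y) = s x y := by
  let L : H →L⋆[ℂ] H →L[ℂ] ℂ := LinearMap.mkContinuous₂
    (LinearMap.mk₂'ₛₗ (starRingEnd ℂ) (RingHom.id ℂ) s add_left
      (fun c x y => smul_left c x y) add_right (fun c x y => smul_right c x y)) C bound
  have hL : ∀ x y, inner ℂ x (star (InnerProductSpace.continuousLinearMapOfBilin L) y) = s x y :=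
    fun x y => by
      rw [inner_star_right, InnerProductSpace.continuousLinearMapOfBilin_apply]
      rfl
  refine ⟨_, ContinuousLinearMap.opNorm_le_bound _ hC fun y => ?_, hL⟩
  set B := star (InnerProductSpace.continuousLinearMapOfBilin L)
  have h1 : ‖B y‖ * ‖B y‖ ≤ C * ‖B y‖ * ‖y‖ := by
    have := bound (B y) y
    rwa [← hL, norm_inner_self_complex] at this
  rcases (norm_nonneg (B y)).eq_or_lt with h | h
  · rw [← h]; positivity
  · nlinarith

/-- Bounded sets of operators are compact in the weak operator topology. -/
theorem exists_weak_limit {α : Type*} (F : Ultrafilter α) (A : α → H →L[ℂ] H) {C : ℝ}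
    (hC : ∀ a, ‖A a‖ ≤ C) : ∃ B : H →L[ℂ] H, ‖B‖ ≤ C ∧
      ∀ x y, Tendsto (fun a => inner ℂ x (A a y)) F (𝓝 (inner ℂ x (B y))) := by
  have hbd : ∀ x y a, ‖inner ℂ x (A a y)‖ ≤ C * ‖x‖ * ‖y‖ := fun x y a =>
    calc ‖inner ℂ x (A a y)‖ ≤ ‖x‖ * ‖A a y‖ := norm_inner_le_norm _ _
      _ ≤ ‖x‖ * (C * ‖y‖) := by gcongr; exact (A a).le_of_opNorm_le (hC a) _
      _ = _ := by ring
  have hlim : ∀ x y, ∃ z, Tendsto (fun a => inner ℂ x (A a y)) F (𝓝 z) ∧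
      ‖z‖ ≤ C * ‖x‖ * ‖y‖ := fun x y => by
    obtain ⟨z, hz, hF⟩ := (isCompact_closedBall (0 : ℂ) (C * ‖x‖ * ‖y‖)).ultrafilter_le_nhds
      (F.map fun a => inner ℂ x (A a y))
      (le_principal_iff.2 (mem_map.2 (Filter.univ_mem' fun a => by simpa using hbd x y a)))
    exact ⟨z, hF, by simpa using hz⟩
  choose s hs hsb using hlim
  have hC0 : 0 ≤ C := by
    obtain ⟨a, -⟩ := F.nonempty_of_mem univ_mem
    exact (norm_nonneg _).trans (hC a)
  obtain ⟨B, hB, hBs⟩ := exists_operator_of_sesquilinear s C hC0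
    (fun x x' y => tendsto_nhds_unique (hs _ _) (by
      simpa [inner_add_left] using (hs x y).add (hs x' y)))
    (fun c x y => tendsto_nhds_unique (hs _ _) (by
      simpa [inner_smul_left, mul_comm] using (hs x y).const_mul (star c)))
    (fun x y y' => tendsto_nhds_unique (hs _ _) (by
      simpa [inner_add_right] using (hs x y).add (hs x y')))
    (fun c x y => tendsto_nhds_unique (hs _ _) (by
      simpa [inner_smul_right] using (hs x y).const_mul c)) hsb
  exact ⟨B, hB, fun x y => by rw [hBs]; exact hs x y⟩

end Sesquilinear

/-! ### Normal functionals and preduals of fixed-point spaces -/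

section Normal

variable {H : Type u} [NormedAddCommGroup H] [InnerProductSpace ℂ H]

section ClosedSpan

variable {F : Type*} [NormedAddCommGroup F] [NormedSpace ℂ F] {s : Set F} {f : F}

/-- The norm-closed linear span of a set. -/
def closedSpan (s : Set F) : Submodule ℂ F := (Submodule.span ℂ s).topologicalClosure

theorem isClosed_closedSpan : IsClosed (closedSpan s : Set F) :=
  Submodule.isClosed_topologicalClosure _

theorem mem_closedSpan (hf : f ∈ s) : f ∈ closedSpan s :=
  Submodule.le_topologicalClosure _ (Submodule.subset_span hf)

theorem exists_norm_sub_lt_of_mem_closedSpan (hf : f ∈ closedSpan s) {ε : ℝ} (hε : 0 < ε) :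
    ∃ g ∈ Submodule.span ℂ s, ‖f - g‖ < ε := by
  obtain ⟨g, hg, hfg⟩ := Metric.mem_closure_iff.1
    (show f ∈ closure (Submodule.span ℂ s : Set F) from hf) ε hε
  exact ⟨g, hg, by rwa [dist_eq_norm] at hfg⟩

theorem mem_closedSpan_of_approx (h : ∀ ε > 0, ∃ g ∈ closedSpan s, ‖f - g‖ < ε) :
    f ∈ closedSpan s := by
  rw [← SetLike.mem_coe, ← isClosed_closedSpan.closure_eq]
  refine Metric.mem_closure_iff.2 fun ε hε => ?_
  obtain ⟨g, hg, hfg⟩ := h ε hε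
  exact ⟨g, hg, by rwa [dist_eq_norm]⟩

theorem apply_eq_of_mem_closedSpan {L L' : StrongDual ℂ F} (h : ∀ g ∈ s, L g = L' g)
    (hf : f ∈ closedSpan s) : L f = L' f := by
  have hle : closedSpan s ≤ LinearMap.eqLocus (L : F →ₗ[ℂ] ℂ) (L' : F →ₗ[ℂ] ℂ) :=
    Submodule.topologicalClosure_minimal _ (Submodule.span_le.2 h)
      (isClosed_eq L.continuous L'.continuous)
  exact hle hf

theorem exists_weak_sum_mem_closedSpan [CompleteSpace F] {ι : Type*} {f : ι → F} {b : ι → ℝ}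
    (hb : Summable b) (hfb : ∀ i, ‖f i‖ ≤ b i) (hf : ∀ i, f i ∈ closedSpan s) :
    ∃ g ∈ closedSpan s, ∀ L : StrongDual ℂ F, HasSum (fun i => L (f i)) (L g) :=
  have hs : Summable f := hb.of_norm_bounded hfb
  ⟨∑' i, f i, isClosed_closedSpan.mem_of_tendsto hs.hasSum
    (.of_forall fun _ => Submodule.sum_mem _ fun i _ => hf i), fun L => hs.hasSum.mapL L⟩

theorem tendsto_apply_of_mem_closedSpan {α : Type*} {l : Filter α} {L : α → StrongDual ℂ F}
    {L' : StrongDual ℂ F} {C : ℝ} (hC : ∀ n, ‖L n‖ ≤ C)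
    (hL : ∀ g ∈ s, Tendsto (fun n => L n g) l (𝓝 (L' g))) (hf : f ∈ closedSpan s) :
    Tendsto (fun n => L n f) l (𝓝 (L' f)) := by
  have hspan : ∀ g ∈ Submodule.span ℂ s, Tendsto (fun n => L n g) l (𝓝 (L' g)) := fun g hg => by
    induction hg using Submodule.span_induction with
    | mem g hg => exact hL g hg
    | zero => simpa using tendsto_const_nhds
    | add g g' _ _ h h' => simpa using h.add h'
    | smul c g _ h => simpa using h.const_mul c
  rw [Metric.tendsto_nhds]
  intro ε hε
  set D := |C| + ‖L'‖ + 1 with hD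
  have hD0 : 0 < D := by positivity
  obtain ⟨g, hg, hfg⟩ := exists_norm_sub_lt_of_mem_closedSpan hf
    (show 0 < ε / (3 * D) by positivity)
  have hsmall : ∀ X : StrongDual ℂ F, ‖X‖ ≤ D → ‖X (f - g)‖ < ε / 3 := fun X hX => by
    calc ‖X (f - g)‖ ≤ ‖X‖ * ‖f - g‖ := X.le_opNorm _
      _ ≤ D * ‖f - g‖ := by gcongr
      _ < D * (ε / (3 * D)) := by gcongr
      _ = ε / 3 := by field_simp
  filter_upwards [Metric.tendsto_nhds.1 (hspan g hg) (ε / 3) (by positivity)] with n hn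
  have h1 := hsmall (L n) ((hC n).trans (by have := le_abs_self C; linarith [norm_nonneg L']))
  have h2 := hsmall L' (by linarith [abs_nonneg C])
  rw [dist_eq_norm] at hn ⊢
  have : L n f - L' f = L n (f - g) + (L n g - L' g) - L' (f - g) := by
    simp only [map_sub]; ring
  rw [this]
  linarith [norm_sub_le (L n (f - g) + (L n g - L' g)) (L' (f - g)),
    norm_add_le (L n (f - g)) (L n g - L' g)]

end ClosedSpan

/-- The vector functional `A ↦ ⟨x, A y⟩`. -/
def vectorFunctional (x y : H) : StrongDual ℂ (H →L[ℂ] H) :=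
  innerSL ℂ x ∘L ContinuousLinearMap.apply ℂ H y

@[simp] theorem vectorFunctional_apply (x y : H) (A : H →L[ℂ] H) :
    vectorFunctional x y A = inner ℂ x (A y) := rfl

theorem norm_vectorFunctional_le (x y : H) : ‖vectorFunctional x y‖ ≤ ‖x‖ * ‖y‖ := by
  refine ContinuousLinearMap.opNorm_le_bound _ (by positivity) fun A => ?_
  calc ‖inner ℂ x (A y)‖ ≤ ‖x‖ * ‖A y‖ := norm_inner_le_norm _ _
    _ ≤ ‖x‖ * (‖A‖ * ‖y‖) := by gcongr; exact A.le_opNorm _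
    _ = ‖x‖ * ‖y‖ * ‖A‖ := by ring

variable (H) in
/-- The normal functionals on `L(H)`: the closed span of the vector functionals. -/
def normalFunctionals : Submodule ℂ (StrongDual ℂ (H →L[ℂ] H)) :=
  closedSpan (Set.range fun p : H × H => vectorFunctional p.1 p.2)

theorem vectorFunctional_mem (x y : H) : vectorFunctional x y ∈ normalFunctionals H :=
  mem_closedSpan ⟨(x, y), rfl⟩

/-- A continuous linear functional on the normal functionals that agrees with evaluation at `B`
on vector functionals is evaluation at `B`. -/
theorem eq_apply_of_mem_normalFunctionals (Ψ : StrongDual ℂ (StrongDual ℂ (H →L[ℂ] H)))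
    (B : H →L[ℂ] H) (h : ∀ x y, Ψ (vectorFunctional x y) = inner ℂ x (B y))
    {f : StrongDual ℂ (H →L[ℂ] H)} (hf : f ∈ normalFunctionals H) : Ψ f = f B :=
  apply_eq_of_mem_closedSpan (L' := ContinuousLinearMap.apply ℂ ℂ B)
    (by rintro _ ⟨p, rfl⟩; exact h _ _) hf

theorem tendsto_normalFunctional {α : Type*} {F : Filter α} {A : α → H →L[ℂ] H} {B : H →L[ℂ] H}
    {C : ℝ} (hC : ∀ n, ‖A n‖ ≤ C)
    (hA : ∀ u v, Tendsto (fun n => inner ℂ u (A n v)) F (𝓝 (inner ℂ u (B v))))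
    {f : StrongDual ℂ (H →L[ℂ] H)} (hf : f ∈ normalFunctionals H) :
    Tendsto (fun n => f (A n)) F (𝓝 (f B)) :=
  tendsto_apply_of_mem_closedSpan (L := fun n => ContinuousLinearMap.apply ℂ ℂ (A n))
    (L' := ContinuousLinearMap.apply ℂ ℂ B) (C := C)
    (fun n => (ContinuousLinearMap.opNorm_le_bound _ (norm_nonneg (A n)) fun f => by
      rw [mul_comm]; exact f.le_opNorm (A n)).trans (hC n))
    (by rintro _ ⟨p, rfl⟩; exact hA _ _) hf

/-- If a subspace `D` of `F` is norming for `E` and every functional on `F` is represented on `D`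
by an element of `E`, then the closure of `D` is a predual of `E`. -/
theorem exists_predual_of_norming {E F : Type u} [NormedAddCommGroup E] [NormedSpace ℂ E]
    [NormedAddCommGroup F] [NormedSpace ℂ F] [CompleteSpace F] (ev : E →ₗ[ℂ] StrongDual ℂ F)
    (D : Submodule ℂ F) (hle : ∀ A f, ‖ev A f‖ ≤ ‖A‖ * ‖f‖)
    (hnorm : ∀ A c, 0 ≤ c → (∀ f ∈ D, ‖ev A f‖ ≤ c * ‖f‖) → ‖A‖ ≤ c)
    (hsurj : ∀ Ψ : StrongDual ℂ F, ∃ A, ∀ f ∈ D, ev A f = Ψ f) :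
    ∃ (X : Type u) (_ : NormedAddCommGroup X) (_ : NormedSpace ℂ X) (_ : CompleteSpace X),
      Nonempty (E ≃ₗᵢ[ℂ] StrongDual ℂ X) := by
  set X : Submodule ℂ F := D.topologicalClosure
  have : CompleteSpace X := (Submodule.isClosed_topologicalClosure D).completeSpace_coe
  let J : E →ₗ[ℂ] StrongDual ℂ X :=
    { toFun := fun A => ev A ∘L X.subtypeL
      map_add' := fun A B => by ext f; simp
      map_smul' := fun c A => by ext f; simp }
  have hJ : ∀ A (f : X), J A f = ev A f := fun A f => rfl
  have hJnorm : ∀ A, ‖J A‖ = ‖A‖ := fun A => le_antisymm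
    (ContinuousLinearMap.opNorm_le_bound (J A) (norm_nonneg A) fun f => hle A f)
    (hnorm A _ (norm_nonneg (J A)) fun f hf =>
      (J A).le_opNorm (⟨f, Submodule.le_topologicalClosure D hf⟩ : X))
  refine ⟨X, inferInstance, inferInstance, inferInstance,
    ⟨LinearIsometryEquiv.ofSurjective ⟨J, hJnorm⟩ fun φ => ?_⟩⟩
  obtain ⟨Ψ, hΨ, -⟩ := exists_extension_norm_eq X φ
  obtain ⟨A, hA⟩ := hsurj Ψ
  refine ⟨A, ContinuousLinearMap.ext fun g => ?_⟩
  change ev A g = φ g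
  rw [← hΨ]
  have hX : X ≤ LinearMap.eqLocus (ev A : F →ₗ[ℂ] ℂ) (Ψ : F →ₗ[ℂ] ℂ) :=
    Submodule.topologicalClosure_minimal _ hA (isClosed_eq (ev A).continuous Ψ.continuous)
  exact hX g.2

variable [CompleteSpace H]

/-- A space of operators is a dual space as soon as it contains every operator `B` for which
evaluation at `B` on normal functionals factors through restriction to the space: a functional `Ψ`
on the restrictions of the normal functionals is evaluation at the operator `B` with matrix
elements `⟨x, B y⟩ = Ψ(⟨x, · y⟩)`. -/
theorem exists_predual_of_isometry {E : Type u} [NormedAddCommGroup E] [NormedSpace ℂ E]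
    (j : E →ₗᵢ[ℂ] (H →L[ℂ] H))
    (hj : ∀ B : H →L[ℂ] H, (∀ f ∈ normalFunctionals H, ∀ g ∈ normalFunctionals H,
      (∀ A, f (j A) = g (j A)) → f B = g B) → B ∈ Set.range j) :
    ∃ (X : Type u) (_ : NormedAddCommGroup X) (_ : NormedSpace ℂ X) (_ : CompleteSpace X),
      Nonempty (E ≃ₗᵢ[ℂ] StrongDual ℂ X) := by
  let R : StrongDual ℂ (H →L[ℂ] H) →L[ℂ] StrongDual ℂ E :=
    (ContinuousLinearMap.compL ℂ E (H →L[ℂ] H) ℂ).flip j.toContinuousLinearMap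
  have hR : ∀ f A, R f A = f (j A) := fun f A => rfl
  have hRle : ∀ x y, ‖R (vectorFunctional x y)‖ ≤ ‖x‖ * ‖y‖ := fun x y =>
    ContinuousLinearMap.opNorm_le_bound _ (by positivity) fun A =>
      ((vectorFunctional x y).le_opNorm (j A)).trans (by
        rw [j.norm_map]
        exact mul_le_mul_of_nonneg_right (norm_vectorFunctional_le x y) (norm_nonneg _))
  refine exists_predual_of_norming
    (ContinuousLinearMap.apply ℂ ℂ : E →L[ℂ] StrongDual ℂ E →L[ℂ] ℂ).toLinearMap
    ((normalFunctionals H).map R.toLinearMap) (fun A f => ?_) (fun A c hc h => ?_) fun Ψ => ?_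
  · rw [mul_comm]
    exact f.le_opNorm A
  · rw [← j.norm_map]
    refine ContinuousLinearMap.opNorm_le_bound _ hc fun y => ?_
    -- the vector functional of `A y` and `y` detects the norm of `A y`
    have h1 := h _ ⟨_, vectorFunctional_mem (j A y) y, rfl⟩
    have h2 : ‖(inner ℂ (j A y) (j A y) : ℂ)‖ ≤ c * (‖j A y‖ * ‖y‖) :=
      h1.trans (mul_le_mul_of_nonneg_left (hRle _ _) hc)
    rw [norm_inner_self_complex] at h2
    rcases (norm_nonneg (j A y)).eq_or_lt with h | h
    · rw [← h]; positivity
    · nlinarith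
  · obtain ⟨B, -, hB⟩ := exists_operator_of_sesquilinear
      (fun x y => Ψ (R (vectorFunctional x y))) ‖Ψ‖ (norm_nonneg _)
      (fun x x' y => by
        rw [← map_add, ← map_add]; congr 2; ext A; simp)
      (fun c x y => by
        rw [← smul_eq_mul, ← map_smul, ← map_smul]
        congr 2; ext A; simp [mul_comm])
      (fun x y y' => by
        rw [← map_add, ← map_add]; congr 2; ext A; simp)
      (fun c x y => by
        rw [← smul_eq_mul, ← map_smul, ← map_smul]; congr 2; ext A; simp)
      (fun x y => by
        rw [mul_assoc]
        exact Ψ.le_of_opNorm_le_of_le le_rfl (hRle x y))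
    have hN : ∀ f ∈ normalFunctionals H, Ψ (R f) = f B := fun f hf =>
      eq_apply_of_mem_normalFunctionals (Ψ ∘L R) B (fun x y => (hB x y).symm) hf
    obtain ⟨A, rfl⟩ := hj B fun f hf g hg hfg => by
      rw [← hN f hf, ← hN g hg]
      congr 1
      ext A
      exact hfg A
    refine ⟨A, ?_⟩
    rintro _ ⟨f, hf, rfl⟩
    exact (hN f hf).symm

/-- The fixed-point space of a normal map `Λ` is a dual space, because the normal functionals
`A ↦ ⟨x, Λ(A) y⟩` and `A ↦ ⟨x, A y⟩` agree on it. -/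
theorem exists_predual_fixedPoints (Λ : (H →L[ℂ] H) →ₗ[ℂ] (H →L[ℂ] H))
    (hΛ : ∀ x y : H, ∃ f ∈ normalFunctionals H, ∀ A, f A = inner ℂ x (Λ A y))
    (hstar : ∀ A ∈ fixedPoints Λ, star A ∈ fixedPoints Λ) :
    ∃ (X : Type u) (_ : NormedAddCommGroup X) (_ : NormedSpace ℂ X) (_ : CompleteSpace X),
      Nonempty (StrongDual ℂ X ≃ₗᵢ⋆[ℂ] fixedPoints Λ) := by
  obtain ⟨X, i₁, i₂, i₃, ⟨e⟩⟩ :=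
    exists_predual_of_isometry (fixedPoints Λ).subtypeₗᵢ fun B hB => by
      refine ⟨⟨B, ?_⟩, rfl⟩
      change Λ B = B
      refine ext_inner_operator fun x y => ?_
      obtain ⟨f, hf, hfA⟩ := hΛ x y
      rw [← hfA]
      refine hB f hf _ (vectorFunctional_mem x y) fun A => ?_
      rw [hfA, vectorFunctional_apply]
      congr 2
      exact A.2
  -- evaluation is linear; composing it with the involution gives the conjugate-linear isomorphism
  let st : fixedPoints Λ ≃ₗᵢ⋆[ℂ] fixedPoints Λ :=
    { toFun := fun A => ⟨star (A : H →L[ℂ] H), hstar A A.2⟩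
      invFun := fun A => ⟨star (A : H →L[ℂ] H), hstar A A.2⟩
      left_inv := fun A => Subtype.ext (star_star _)
      right_inv := fun A => Subtype.ext (star_star _)
      map_add' := fun A B => Subtype.ext (star_add _ _)
      map_smul' := fun c A => Subtype.ext (star_smul c (A : H →L[ℂ] H))
      norm_map' := fun A => norm_star (A : H →L[ℂ] H) }
  exact ⟨X, i₁, i₂, i₃, ⟨e.symm.trans st⟩⟩

end Normal

/-! ### Tensor products of operators -/

section Tensor

open scoped ComplexOrder

variable {H : Type u} [NormedAddCommGroup H] [InnerProductSpace ℂ H]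

/-- The elementary tensor `x ⊗ y` in the Hilbert space tensor product. -/
def pureTensor (x y : H) : HilbertTensor H := ((x ⊗ₜ[ℂ] y : H ⊗[ℂ] H) : HilbertTensor H)

theorem inner_pureTensor (x y x' y' : H) :
    inner ℂ (pureTensor x y) (pureTensor x' y') = inner ℂ x x' * inner ℂ y y' := by
  rw [pureTensor, pureTensor, UniformSpace.Completion.inner_coe, TensorProduct.inner_tmul]

theorem norm_pureTensor (x y : H) : ‖pureTensor x y‖ = ‖x‖ * ‖y‖ := by
  rw [pureTensor, UniformSpace.Completion.norm_coe, TensorProduct.norm_tmul]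

theorem opTensor_pureTensor (A B : H →L[ℂ] H) (x y : H) :
    opTensor A B (pureTensor x y) = pureTensor (A x) (B y) := by
  rw [pureTensor, opTensor_apply_coe, TensorProduct.mapL_tmul, pureTensor]

/-- A closed additive property of vectors of the Hilbert space tensor product holds everywhere if
it holds for elementary tensors. -/
theorem hilbertTensor_induction {p : HilbertTensor H → Prop} (hclosed : IsClosed {ξ | p ξ})
    (hadd : ∀ ξ η, p ξ → p η → p (ξ + η)) (hzero : p 0)
    (hpure : ∀ x y, p (pureTensor x y)) (ξ : HilbertTensor H) : p ξ := by
  induction ξ using UniformSpace.Completion.induction_on with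
  | hp => exact hclosed
  | ih t =>
    induction t using TensorProduct.induction_on with
    | zero => rw [UniformSpace.Completion.coe_zero]; exact hzero
    | tmul x y => exact hpure x y
    | add t s ht hs =>
      rw [UniformSpace.Completion.coe_add]
      exact hadd _ _ ht hs

theorem hilbertTensor_ext {S T : HilbertTensor H →L[ℂ] HilbertTensor H}
    (h : ∀ x y, S (pureTensor x y) = T (pureTensor x y)) : S = T :=
  ContinuousLinearMap.ext <| hilbertTensor_induction (isClosed_eq S.continuous T.continuous)
    (fun ξ η hξ hη => by rw [map_add, map_add, hξ, hη]) (by rw [map_zero, map_zero]) h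

theorem opTensor_one : opTensor (1 : H →L[ℂ] H) 1 = 1 :=
  hilbertTensor_ext fun x y => by rw [opTensor_pureTensor]; rfl

theorem opTensor_mul (A B A' B' : H →L[ℂ] H) :
    opTensor A B * opTensor A' B' = opTensor (A * A') (B * B') :=
  hilbertTensor_ext fun x y => by
    rw [mul_apply_eq_comp, opTensor_pureTensor, opTensor_pureTensor, opTensor_pureTensor]; rfl

variable [CompleteSpace H]

theorem opTensor_star (A B : H →L[ℂ] H) : star (opTensor A B) = opTensor (star A) (star B) := by
  refine ext_inner_operator fun ξ η => ?_
  rw [inner_star_right]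
  refine hilbertTensor_induction (p := fun ξ => inner ℂ (opTensor A B ξ) η =
    inner ℂ ξ (opTensor (star A) (star B) η)) ?_ ?_ ?_ (fun x y => ?_) ξ
  · exact isClosed_eq (by fun_prop) (by fun_prop)
  · intro ξ ξ' h h'
    rw [map_add, inner_add_left, inner_add_left, h, h']
  · simp
  refine hilbertTensor_induction (p := fun η => inner ℂ (opTensor A B (pureTensor x y)) η =
    inner ℂ (pureTensor x y) (opTensor (star A) (star B) η)) ?_ ?_ ?_ (fun x' y' => ?_) η
  · exact isClosed_eq (by fun_prop) (by fun_prop)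
  · intro ξ ξ' h h'
    rw [map_add, inner_add_right, inner_add_right, h, h']
  · simp
  rw [opTensor_pureTensor, opTensor_pureTensor, inner_pureTensor, inner_pureTensor,
    inner_star_right, inner_star_right]

variable (H) in
/-- The embedding `A ↦ A ⊗ 1` of `L(H)` into `L(H ⊗ H)`. -/
def opTensorOne : (H →L[ℂ] H) →⋆ₐ[ℂ] (HilbertTensor H →L[ℂ] HilbertTensor H) where
  toFun A := opTensor A 1
  map_one' := opTensor_one
  map_mul' A B := by rw [opTensor_mul, one_mul]
  map_zero' := by
    have := opTensor_smul_left 0 (0 : H →L[ℂ] H) 1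
    rwa [zero_smul, zero_smul] at this
  map_add' A B := opTensor_add_left A B 1
  commutes' c := by
    rw [Algebra.algebraMap_eq_smul_one, Algebra.algebraMap_eq_smul_one, opTensor_smul_left,
      opTensor_one]
  map_star' A := by rw [opTensor_star, star_one]

theorem norm_opTensor_one_le (A : H →L[ℂ] H) : ‖opTensor A 1‖ ≤ ‖A‖ :=
  NonUnitalStarAlgHom.norm_apply_le (opTensorOne H) A

theorem sum_inner_opTensor_one_nonneg {n : Type*} [Fintype n] {M : n → n → H →L[ℂ] H}
    (hM : ∀ x : n → H, 0 ≤ (∑ i, ∑ j, inner ℂ (x i) (M i j (x j)) : ℂ))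
    (ξ : n → HilbertTensor H) :
    0 ≤ (∑ i, ∑ j, inner ℂ (ξ i) (opTensor (M i j) 1 (ξ j)) : ℂ) :=
  sum_inner_map_nonneg
    (CompletelyPositiveMapClass.toCompletelyPositiveLinearMap (opTensorOne H)) hM ξ

/-- The functional `A ↦ ⟨ξ, (A ⊗ 1) η⟩`. -/
def tensorFunctional (ξ η : HilbertTensor H) : StrongDual ℂ (H →L[ℂ] H) :=
  LinearMap.mkContinuous
    ((vectorFunctional ξ η).toLinearMap ∘ₗ (opTensorOne H).toAlgHom.toLinearMap) (‖ξ‖ * ‖η‖)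
    fun A => ((vectorFunctional ξ η).le_opNorm _).trans
      (mul_le_mul (norm_vectorFunctional_le ξ η) (norm_opTensor_one_le A) (norm_nonneg _)
        (by positivity))

@[simp] theorem tensorFunctional_apply (ξ η : HilbertTensor H) (A : H →L[ℂ] H) :
    tensorFunctional ξ η A = inner ℂ ξ (opTensor A 1 η) := rfl

theorem norm_tensorFunctional_le (ξ η : HilbertTensor H) : ‖tensorFunctional ξ η‖ ≤ ‖ξ‖ * ‖η‖ :=
  LinearMap.mkContinuous_norm_le _ (by positivity) _

/-- Normality of the embedding `A ↦ A ⊗ 1`: this replaces the partial trace. -/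
theorem tensorFunctional_mem (ξ η : HilbertTensor H) :
    tensorFunctional ξ η ∈ normalFunctionals H := by
  have hpure : ∀ x y x' y' : H,
      tensorFunctional (pureTensor x y) (pureTensor x' y') ∈ normalFunctionals H := by
    intro x y x' y'
    have : tensorFunctional (pureTensor x y) (pureTensor x' y') =
        (inner ℂ y y' : ℂ) • vectorFunctional x x' := by
      ext A
      rw [tensorFunctional_apply, opTensor_pureTensor, inner_pureTensor, mul_comm]
      rfl
    rw [this]
    exact Submodule.smul_mem _ _ (vectorFunctional_mem _ _)
  have closed_left : ∀ η : HilbertTensor H,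
      IsClosed {ξ | tensorFunctional ξ η ∈ normalFunctionals H} := fun η => by
    refine isClosed_of_closure_subset fun ξ hξ => mem_closedSpan_of_approx fun ε hε => ?_
    obtain ⟨ξ', hξ', hd⟩ := Metric.mem_closure_iff.1 hξ (ε / (‖η‖ + 1)) (by positivity)
    refine ⟨_, hξ', ?_⟩
    have : tensorFunctional ξ η - tensorFunctional ξ' η = tensorFunctional (ξ - ξ') η := by
      ext A; simp [inner_sub_left]
    rw [this]
    rw [dist_eq_norm, lt_div_iff₀ (by positivity)] at hd
    refine (norm_tensorFunctional_le _ _).trans_lt (lt_of_le_of_lt ?_ hd)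
    gcongr; linarith
  have closed_right : ∀ ξ : HilbertTensor H,
      IsClosed {η | tensorFunctional ξ η ∈ normalFunctionals H} := fun ξ => by
    refine isClosed_of_closure_subset fun η hη => mem_closedSpan_of_approx fun ε hε => ?_
    obtain ⟨η', hη', hd⟩ := Metric.mem_closure_iff.1 hη (ε / (‖ξ‖ + 1)) (by positivity)
    refine ⟨_, hη', ?_⟩
    have : tensorFunctional ξ η - tensorFunctional ξ η' = tensorFunctional ξ (η - η') := by
      ext A; simp [inner_sub_right]
    rw [this]
    rw [dist_eq_norm, lt_div_iff₀ (by positivity), mul_comm] at hd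
    refine (norm_tensorFunctional_le _ _).trans_lt (lt_of_le_of_lt ?_ hd)
    gcongr; linarith
  refine hilbertTensor_induction (closed_left η) (fun ξ ξ' h h' => ?_) ?_ (fun x y => ?_) ξ
  · have : tensorFunctional (ξ + ξ') η = tensorFunctional ξ η + tensorFunctional ξ' η := by
      ext A; simp [inner_add_left]
    rw [this]
    exact Submodule.add_mem _ h h'
  · have : tensorFunctional 0 η = 0 := by ext A; simp
    rw [this]
    exact Submodule.zero_mem _
  refine hilbertTensor_induction (closed_right _) (fun ξ ξ' h h' => ?_) ?_ (fun x' y' => ?_) η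
  · have : tensorFunctional (pureTensor x y) (ξ + ξ') =
        tensorFunctional (pureTensor x y) ξ + tensorFunctional (pureTensor x y) ξ' := by
      ext A; simp [inner_add_right]
    rw [this]
    exact Submodule.add_mem _ h h'
  · have : tensorFunctional (pureTensor x y) 0 = 0 := by ext A; simp
    rw [this]
    exact Submodule.zero_mem _
  exact hpure _ _ _ _

/-- The marginal of a channel is normal: `A ↦ ⟨x, Φ(A ⊗ 1) y⟩` is a norm-convergent series of
functionals `A ↦ ⟨ξ, (A ⊗ 1) η⟩`. -/
theorem exists_normalFunctional_marginal
    {Φ : (HilbertTensor H →L[ℂ] HilbertTensor H) →CP (H →L[ℂ] H)} (hΦ : IsChannel Φ) (x y : H) :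
    ∃ f ∈ normalFunctionals H, ∀ A, f A = inner ℂ x (marginal Φ A y) := by
  obtain ⟨T, hT, hΦT⟩ := hΦ.normal _ (isTraceClass_rankOne y x)
  obtain ⟨ξ, η, h⟩ := hT.exists_nuclearRep
  obtain ⟨f, hf, hfA⟩ := exists_weak_sum_mem_closedSpan h.summable_mul
    (fun i => norm_tensorFunctional_le (ξ i) (η i)) (fun i => tensorFunctional_mem (ξ i) (η i))
  refine ⟨f, hf, fun A => ?_⟩
  have h1 : HasSum (fun i => inner ℂ (ξ i) (opTensor A 1 (η i))) (f A) :=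
    hfA (ContinuousLinearMap.apply ℂ ℂ A)
  rw [h1.unique (h.hasSum_trace_mul (opTensor A 1)), ← hΦT, trace_rankOne_mul]
  rfl

end Tensor

/-! ### Cesàro limits and the product on the fixed points -/

section Cesaro

open scoped ComplexOrder

variable {H : Type u} [NormedAddCommGroup H] [InnerProductSpace ℂ H]

/-- The Cesàro mean `(1/n) ∑_{k<n} Λᵏ`. -/
def cesaroMean (Λ : (H →L[ℂ] H) →ₗ[ℂ] (H →L[ℂ] H)) (n : ℕ) (A : H →L[ℂ] H) : H →L[ℂ] H :=
  (n : ℂ)⁻¹ • ∑ k ∈ Finset.range n, (Λ ^ k) A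

variable {Λ : (H →L[ℂ] H) →ₗ[ℂ] (H →L[ℂ] H)}

theorem norm_pow_apply_le (hΛ : ∀ A, ‖Λ A‖ ≤ ‖A‖) (k : ℕ) (A : H →L[ℂ] H) :
    ‖(Λ ^ k) A‖ ≤ ‖A‖ := by
  induction k with
  | zero => simp
  | succ k ih => rw [pow_succ', Module.End.mul_apply]; exact (hΛ _).trans ih

theorem norm_cesaroMean_le (hΛ : ∀ A, ‖Λ A‖ ≤ ‖A‖) (n : ℕ) (A : H →L[ℂ] H) :
    ‖cesaroMean Λ n A‖ ≤ ‖A‖ := by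
  rw [cesaroMean, norm_smul, norm_inv, Complex.norm_natCast]
  have h1 : ‖∑ k ∈ Finset.range n, (Λ ^ k) A‖ ≤ n * ‖A‖ := by
    simpa using norm_sum_le_of_le (Finset.range n) fun k _ => norm_pow_apply_le hΛ k A
  rcases n.eq_zero_or_pos with rfl | hn
  · simp
  · have : (0 : ℝ) < n := by exact_mod_cast hn
    rw [inv_mul_le_iff₀ this]
    exact h1

theorem cesaroMean_map (n : ℕ) (A : H →L[ℂ] H) :
    cesaroMean Λ n (Λ A) = Λ (cesaroMean Λ n A) := by
  simp only [cesaroMean, map_smul, map_sum, ← Module.End.mul_apply, ← pow_succ, ← pow_succ']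

theorem cesaroMean_map_sub (n : ℕ) (A : H →L[ℂ] H) :
    cesaroMean Λ n (Λ A) - cesaroMean Λ n A = (n : ℂ)⁻¹ • ((Λ ^ n) A - A) := by
  rw [cesaroMean, cesaroMean, ← smul_sub, ← Finset.sum_sub_distrib]
  simp only [← Module.End.mul_apply, ← pow_succ]
  rw [Finset.sum_range_sub (fun k => (Λ ^ k) A)]
  simp

theorem cesaroMean_of_fixed {A : H →L[ℂ] H} (hA : Λ A = A) {n : ℕ} (hn : n ≠ 0) :
    cesaroMean Λ n A = A := by
  have : ∀ k, (Λ ^ k) A = A := fun k => by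
    induction k with
    | zero => simp
    | succ k ih => rw [pow_succ, Module.End.mul_apply, hA, ih]
  have hn' : (n : ℂ) ≠ 0 := by exact_mod_cast hn
  simp only [cesaroMean, this, Finset.sum_const, Finset.card_range, ← Nat.cast_smul_eq_nsmul ℂ,
    smul_smul]
  rw [inv_mul_cancel₀ hn', one_smul]

theorem tendsto_cesaroMean_map_sub (hΛ : ∀ A, ‖Λ A‖ ≤ ‖A‖) (A : H →L[ℂ] H) :
    Tendsto (fun n => cesaroMean Λ n (Λ A) - cesaroMean Λ n A) atTop (𝓝 0) := by
  refine squeeze_zero_norm (a := fun n : ℕ => (n : ℝ)⁻¹ * (‖A‖ + ‖A‖)) (fun n => ?_) ?_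
  · rw [cesaroMean_map_sub, norm_smul, norm_inv, Complex.norm_natCast]
    gcongr
    exact (norm_sub_le _ _).trans (add_le_add_left (norm_pow_apply_le hΛ n A) _)
  · simpa using tendsto_inv_atTop_nhds_zero_nat.mul_const (‖A‖ + ‖A‖)

variable [CompleteSpace H]

/-- A contractive, completely positive and normal map has a completely positive projection onto
its fixed points, obtained as a weak limit of Cesàro means along an ultrafilter. -/
theorem exists_fixedPointProjection (hΛ : ∀ A, ‖Λ A‖ ≤ ‖A‖)
    (hpos : ∀ (k : ℕ) (M : Fin k → Fin k → H →L[ℂ] H),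
      (∀ x : Fin k → H, 0 ≤ ∑ i, ∑ j, inner ℂ (x i) (M i j (x j))) →
      ∀ x : Fin k → H, 0 ≤ ∑ i, ∑ j, inner ℂ (x i) (Λ (M i j) (x j)))
    (hnormal : ∀ x y : H, ∃ f ∈ normalFunctionals H, ∀ A, f A = inner ℂ x (Λ A y)) :
    ∃ ψ : (H →L[ℂ] H) →CP (H →L[ℂ] H), IsFixedPointProjection Λ ψ ∧ IsCesaroLimit Λ ψ := by
  let F : Ultrafilter ℕ := Ultrafilter.of atTop
  have hF : (F : Filter ℕ) ≤ atTop := Ultrafilter.of_le atTop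
  choose ψ hψn hψ using fun A => exists_weak_limit F (fun n => cesaroMean Λ n A)
    (fun n => norm_cesaroMean_le hΛ n A)
  have huniq : ∀ {A B : H →L[ℂ] H}, (∀ x y, Tendsto (fun n => inner ℂ x (cesaroMean Λ n A y)) F
      (𝓝 (inner ℂ x (B y)))) → ψ A = B := fun {A B} h =>
    ext_inner_operator fun x y => tendsto_nhds_unique (hψ A x y) (h x y)
  let ψl : (H →L[ℂ] H) →ₗ[ℂ] (H →L[ℂ] H) :=
    { toFun := ψ
      map_add' := fun A B => huniq fun x y => by
        have : ∀ n, cesaroMean Λ n (A + B) = cesaroMean Λ n A + cesaroMean Λ n B := fun n => by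
          simp [cesaroMean, Finset.sum_add_distrib]
        simpa [this, inner_add_right] using (hψ A x y).add (hψ B x y)
      map_smul' := fun c A => huniq fun x y => by
        have : ∀ n, cesaroMean Λ n (c • A) = c • cesaroMean Λ n A := fun n => by
          simp [cesaroMean, ← Finset.smul_sum, smul_comm c]
        simpa [this, inner_smul_right] using (hψ A x y).const_mul c }
  have hpow : ∀ (m k : ℕ) (M : Fin k → Fin k → H →L[ℂ] H),
      (∀ x : Fin k → H, 0 ≤ (∑ i, ∑ j, inner ℂ (x i) (M i j (x j)) : ℂ)) →
      ∀ x : Fin k → H, 0 ≤ (∑ i, ∑ j, inner ℂ (x i) ((Λ ^ m) (M i j) (x j)) : ℂ) := by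
    intro m
    induction m with
    | zero => intro k M hM x; simpa using hM x
    | succ m ih =>
      intro k M hM
      simp only [pow_succ', Module.End.mul_apply]
      exact hpos k _ (ih k M hM)
  let ψc : (H →L[ℂ] H) →CP (H →L[ℂ] H) := cpOfForm ψl fun k M hM x => by
    have hlim : Tendsto (fun n => ∑ i, ∑ j, inner ℂ (x i) (cesaroMean Λ n (M i j) (x j))) F
        (𝓝 (∑ i, ∑ j, inner ℂ (x i) (ψ (M i j) (x j)))) :=
      tendsto_finsetSum _ fun i _ => tendsto_finsetSum _ fun j _ => hψ _ _ _
    refine ge_of_tendsto' hlim fun n => ?_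
    have : ∑ i, ∑ j, inner ℂ (x i) (cesaroMean Λ n (M i j) (x j)) =
        (n : ℂ)⁻¹ * ∑ m ∈ Finset.range n, ∑ i, ∑ j, inner ℂ (x i) ((Λ ^ m) (M i j) (x j)) := by
      simp only [cesaroMean, _root_.smul_apply, _root_.sum_apply, inner_smul_right, inner_sum,
        ← Finset.mul_sum]
      rw [Finset.sum_comm_cycle]
    rw [this]
    exact mul_nonneg (by positivity) (Finset.sum_nonneg fun m _ => hpow m k M hM x)
  have hψc : ∀ A, ψc A = ψ A := fun A => rfl
  have hsub : ∀ A x y, Tendsto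
      (fun n => inner ℂ x ((cesaroMean Λ n (Λ A) - cesaroMean Λ n A) y)) F (𝓝 0) := fun A x y => by
    have := ((vectorFunctional x y).continuous.tendsto 0).comp
      ((tendsto_cesaroMean_map_sub hΛ A).mono_left hF)
    rwa [map_zero] at this
  have hmap : ∀ A x y, Tendsto (fun n => inner ℂ x (cesaroMean Λ n (Λ A) y)) F
      (𝓝 (inner ℂ x (ψ A y))) := fun A x y => by
    have := (hψ A x y).add (hsub A x y)
    simpa [inner_sub_right] using this
  have hcomp : ∀ A, ψ (Λ A) = ψ A := fun A => huniq (hmap A)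
  -- the limit is fixed: `⟨x, Λ(·) y⟩` is normal, hence continuous along the bounded means
  have hfix : ∀ A, Λ (ψ A) = ψ A := fun A => ext_inner_operator fun x y => by
    obtain ⟨f, hf, hfA⟩ := hnormal x y
    have h1 := tendsto_normalFunctional (fun n => norm_cesaroMean_le hΛ n A) (hψ A) hf
    simp only [hfA, ← cesaroMean_map] at h1
    exact tendsto_nhds_unique h1 (hmap A x y)
  have hid : ∀ A, Λ A = A → ψ A = A := fun A hA => huniq fun x y => by
    refine tendsto_const_nhds.congr' ?_
    filter_upwards [hF (eventually_ne_atTop 0)] with n hn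
    rw [cesaroMean_of_fixed hA hn]
  refine ⟨ψc, ⟨fun A => hid _ (hfix A), hcomp, ?_⟩, F, inferInstance, hF, fun A T hT => ?_⟩
  · ext A
    constructor
    · rintro ⟨B, rfl⟩
      exact hfix B
    · intro hA
      exact ⟨A, hid A hA⟩
  · exact tendsto_trace_mul (fun n => norm_cesaroMean_le hΛ n A) (hψ A) hT

end Cesaro

section Broadcast

open scoped ComplexOrder

variable {H : Type u} [NormedAddCommGroup H] [InnerProductSpace ℂ H] [CompleteSpace H]
variable {Φ : (HilbertTensor H →L[ℂ] HilbertTensor H) →CP (H →L[ℂ] H)}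

theorem norm_marginal_le (hΦ : IsChannel Φ) (A : H →L[ℂ] H) : ‖marginal Φ A‖ ≤ ‖A‖ :=
  (norm_map_le Φ hΦ.map_one _).trans (norm_opTensor_one_le A)

theorem exists_fixedPointProjection_marginal (hΦ : IsChannel Φ) :
    ∃ ψ : (H →L[ℂ] H) →CP (H →L[ℂ] H),
      IsFixedPointProjection (marginal Φ) ψ ∧ IsCesaroLimit (marginal Φ) ψ :=
  exists_fixedPointProjection (norm_marginal_le hΦ)
    (fun _ _ hM => sum_inner_map_nonneg Φ (sum_inner_opTensor_one_nonneg hM))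
    (exists_normalFunctional_marginal hΦ)

/-- On fixed points of the marginal, the broadcast product is the Choi–Effros product: the Schwarz
inequality for `Φ` at `A ⊗ 1` is saturated after applying `ψ`. -/
theorem map_opTensor_eq_map_mul (hΦ : IsSymmetricChannel Φ) {ψ : (H →L[ℂ] H) →CP (H →L[ℂ] H)}
    (hψ : IsFixedPointProjection (marginal Φ) ψ) {A B : H →L[ℂ] H}
    (hA : A ∈ fixedPoints (marginal Φ)) (hB : B ∈ fixedPoints (marginal Φ)) :
    ψ (Φ (opTensor A B)) = ψ (A * B) := by
  have hA' : Φ (opTensor (star A) 1) = star A := by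
    rw [← star_one, ← opTensor_star, cp_map_star]
    exact congrArg star hA
  have hB' : Φ (opTensor 1 B) = B := by rw [hΦ.symm]; exact hB
  have := map_star_mul_of_saturated Φ hΦ.isChannel.map_one ψ (A := opTensor (star A) 1)
    (by
      rw [hA', opTensor_star, opTensor_mul, star_one, one_mul]
      exact hψ.comp_eq _) (opTensor 1 B)
  rwa [hA', hB', opTensor_star, opTensor_mul, star_one, one_mul, mul_one, star_star] at this

theorem isCommVonNeumannProduct_broadcastProduct (hΦ : IsSymmetricChannel Φ)
    {ψ : (H →L[ℂ] H) →CP (H →L[ℂ] H)} (hψ : IsFixedPointProjection (marginal Φ) ψ) :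
    IsCommVonNeumannProduct (fixedPoints (marginal Φ)) (broadcastProduct Φ ψ) := by
  have hproj : IsProjectionOnto (fixedPoints (marginal Φ)) ψ :=
    ⟨hψ.idempotent, hψ.range_eq, by
      change Φ (opTensor 1 1) = 1
      rw [opTensor_one, hΦ.isChannel.map_one]⟩
  have hcont : Continuous (marginal Φ) :=
    AddMonoidHomClass.continuous_of_bound (marginal Φ) 1 fun A => by
      rw [one_mul]; exact norm_marginal_le hΦ.isChannel A
  have hclosed : IsClosed (fixedPoints (marginal Φ) : Set (H →L[ℂ] H)) :=
    isClosed_eq hcont continuous_id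
  have := hproj.isCommVonNeumannProduct hclosed
    (fun A hA B hB => by
      rw [← map_opTensor_eq_map_mul hΦ hψ hA hB, ← map_opTensor_eq_map_mul hΦ hψ hB hA, hΦ.symm])
    (exists_predual_fixedPoints _ (exists_normalFunctional_marginal hΦ.isChannel)
      fun A hA => hproj.star_mem hA)
  convert this using 3 with A B
  exact map_opTensor_eq_map_mul hΦ hψ A.2 B.2

end Broadcast

/-! ### Positive trace-class operators -/

section PositiveTraceClass

open scoped ComplexOrder

variable {H : Type u} [NormedAddCommGroup H] [InnerProductSpace ℂ H]

theorem inner_map_self_nonneg {T : H →L[ℂ] H} (hT : T.IsPositive) (v : H) :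
    (0 : ℂ) ≤ inner ℂ v (T v) := hT.inner_nonneg_right v

theorem inner_self_eq_ofReal (v : H) : (inner ℂ v v : ℂ) = ((‖v‖ ^ 2 : ℝ) : ℂ) := by
  rw [inner_self_eq_norm_sq_to_K]
  push_cast
  rfl

theorem NuclearRep.isPositive {κ : Type*} {z : κ → H} {T : H →L[ℂ] H} (h : NuclearRep z z T) :
    T.IsPositive := isPositive_of_inner_nonneg fun v => by
  have := (h.hasSum v).mapL (innerSL ℂ v)
  refine this.nonneg fun k => ?_
  rw [innerSL_apply_apply, inner_smul_right, ← inner_conj_symm v (z k)]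
  exact (mul_star_self_nonneg _)

theorem summable_norm_add_sq {E : Type*} [NormedAddCommGroup E] {ι : Type*} {x y : ι → E}
    (hx : Summable fun i => ‖x i‖ ^ 2)
    (hy : Summable fun i => ‖y i‖ ^ 2) : Summable fun i => ‖x i + y i‖ ^ 2 := by
  refine ((hx.add hy).mul_left 2).of_nonneg_of_le (fun _ => by positivity) fun i => ?_
  have : ‖x i + y i‖ ^ 2 ≤ (‖x i‖ + ‖y i‖) ^ 2 := by gcongr; exact norm_add_le _ _
  nlinarith [sq_nonneg (‖x i‖ - ‖y i‖)]

/-- Polarization, with the four vectors `y + iᵏ x`. -/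
theorem inner_map_eq_polarization (A : H →L[ℂ] H) (x y : H) :
    inner ℂ x (A y) = 1 / 4 * inner ℂ (y + (1 : ℂ) • x) (A (y + (1 : ℂ) • x)) +
      -1 / 4 * inner ℂ (y + (-1 : ℂ) • x) (A (y + (-1 : ℂ) • x)) +
      Complex.I / 4 * inner ℂ (y + Complex.I • x) (A (y + Complex.I • x)) +
      -Complex.I / 4 * inner ℂ (y + (-Complex.I) • x) (A (y + (-Complex.I) • x)) := by
  simp only [map_add, map_smul, inner_add_left, inner_add_right, inner_smul_left,
    inner_smul_right, map_neg, Complex.conj_I, map_one]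
  linear_combination (1 / 2 * inner ℂ x (A y) - 1 / 2 * inner ℂ y (A x)) * Complex.I_sq

variable [CompleteSpace H]

theorem _root_.ContinuousLinearMap.IsPositive.exists_isSelfAdjoint_mul_self {T : H →L[ℂ] H}
    (hT : T.IsPositive) : ∃ S : H →L[ℂ] H, star S = S ∧ T = S * S :=
  have h : 0 ≤ T := (ContinuousLinearMap.nonneg_iff_isPositive T).2 hT
  ⟨CFC.sqrt T, (CFC.sqrt_nonneg T).isSelfAdjoint, (CFC.sqrt_mul_sqrt_self T h).symm⟩

/-- A positive operator `T` with summable diagonal is nuclear: with `S = √T` one has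
`T = ∑ₖ |S bₖ⟩⟨S bₖ|`. -/
theorem exists_nuclearRep_of_summable_diag {T : H →L[ℂ] H} (hT : T.IsPositive) {κ : Type*}
    (b : HilbertBasis κ ℂ H) (h : Summable fun k => inner ℂ (b k) (T (b k))) :
    ∃ z : κ → H, NuclearRep z z T := by
  obtain ⟨S, hS, rfl⟩ := hT.exists_isSelfAdjoint_mul_self
  have hs : Summable fun k => ‖S (b k)‖ ^ 2 := by
    refine Complex.summable_ofReal.1 (h.congr fun k => ?_)
    rw [← inner_self_eq_ofReal, mul_apply_eq_comp]
    nth_rw 1 [← hS]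
    exact inner_star_right S _ _
  refine ⟨fun k => S (b k), hs, hs, fun v => ?_⟩
  have h1 := (b.hasSum_repr (S v)).mapL S
  simp only [map_smul, b.repr_apply_apply] at h1
  have h2 : ∀ k, inner ℂ (S (b k)) v = inner ℂ (b k) (S v) := fun k => by
    rw [← inner_star_right, hS]
  simpa only [h2, mul_apply_eq_comp] using h1

theorem IsTraceClass.exists_nuclearRep_self {T : H →L[ℂ] H} (hT : IsTraceClass T)
    (hpos : T.IsPositive) : ∃ (κ : Type u) (z : κ → H), NuclearRep z z T :=
  ⟨_, exists_nuclearRep_of_summable_diag hpos (exists_hilbertBasis ℂ H).choose_spec.choose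
    (hT.hasSum_diag _).summable⟩

theorem NuclearRep.hasSum_norm_sq {κ : Type*} {z : κ → H} {T : H →L[ℂ] H}
    (h : NuclearRep z z T) : HasSum (fun k => ‖z k‖ ^ 2) (trace T).re := by
  have := (h.hasSum_trace_mul 1).mapL Complex.reCLM
  simpa [← Complex.ofReal_pow] using this

theorem trace_mul_nonneg {T N : H →L[ℂ] H} (hT : IsTraceClass T) (hpos : T.IsPositive)
    (hN : N.IsPositive) : 0 ≤ trace (T * N) := by
  obtain ⟨κ, z, h⟩ := hT.exists_nuclearRep_self hpos
  exact (h.hasSum_trace_mul N).nonneg fun k => inner_map_self_nonneg hN _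

/-- The trace norm of a positive operator is its trace. -/
theorem norm_trace_mul_le {T : H →L[ℂ] H} (hT : IsTraceClass T) (hpos : T.IsPositive)
    (A : H →L[ℂ] H) : ‖trace (T * A)‖ ≤ (trace T).re * ‖A‖ := by
  obtain ⟨κ, z, h⟩ := hT.exists_nuclearRep_self hpos
  rw [← (h.hasSum_trace_mul A).tsum_eq]
  refine tsum_of_norm_bounded (h.hasSum_norm_sq.mul_right ‖A‖) fun k => ?_
  calc ‖inner ℂ (z k) (A (z k))‖ ≤ ‖z k‖ * ‖A (z k)‖ := norm_inner_le_norm _ _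
    _ ≤ ‖z k‖ * (‖A‖ * ‖z k‖) := by gcongr; exact A.le_opNorm _
    _ = ‖z k‖ ^ 2 * ‖A‖ := by ring

theorem IsDensityOperator.norm_trace_mul_le {ρ : H →L[ℂ] H} (hρ : IsDensityOperator ρ)
    (A : H →L[ℂ] H) : ‖trace (ρ * A)‖ ≤ ‖A‖ := by
  simpa [hρ.trace_eq_one] using QChannel.norm_trace_mul_le hρ.isTraceClass hρ.isPositive A

/-- `tr (T R⋆ R) = tr (R T R⋆)`, computed along a basis. -/
theorem hasSum_trace_mul_star_mul_self {T : H →L[ℂ] H} (hT : IsTraceClass T) {κ : Type*}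
    (b : HilbertBasis κ ℂ H) (R : H →L[ℂ] H) :
    HasSum (fun k => inner ℂ (star R (b k)) (T (star R (b k)))) (trace (T * (star R * R))) := by
  rw [← mul_assoc, ← trace_mul_comm (hT.mul_right _)]
  convert ((hT.mul_right (star R)).mul_left R).hasSum_diag b using 2 with k
  rw [inner_star_left]
  rfl

theorem isDensityOperator_rankOne {v : H} (hv : ‖v‖ = 1) :
    IsDensityOperator (InnerProductSpace.rankOne ℂ v v) where
  isPositive := isPositive_of_inner_nonneg fun w => by
    rw [InnerProductSpace.rankOne_apply, inner_smul_right, ← inner_conj_symm v w, mul_comm]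
    exact mul_star_self_nonneg _
  isTraceClass := isTraceClass_rankOne v v
  trace_eq_one := by
    rw [← mul_one (InnerProductSpace.rankOne ℂ v v), trace_rankOne_mul, one_apply_eq_self,
      inner_self_eq_ofReal, hv]
    simp

theorem exists_nuclearRep_of_summable_sq {ι : Type*} {x y : ι → H}
    (hx : Summable fun i => ‖x i‖ ^ 2) (hy : Summable fun i => ‖y i‖ ^ 2) :
    ∃ T : H →L[ℂ] H, NuclearRep x y T := by
  have hs : Summable fun i => InnerProductSpace.rankOne ℂ (y i) (x i) := by
    refine (hx.add hy).of_norm_bounded fun i => ?_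
    rw [InnerProductSpace.norm_rankOne, mul_comm]
    exact norm_mul_norm_le _ _
  refine ⟨∑' i, InnerProductSpace.rankOne ℂ (y i) (x i), hx, hy, fun v => ?_⟩
  simpa using hs.hasSum.mapL (ContinuousLinearMap.apply ℂ H v)

/-- The functional of a trace-class operator `∑ₙ |yₙ⟩⟨xₙ|` is a combination of the functionals of
the four positive operators `∑ₙ |yₙ + iᵏ xₙ⟩⟨yₙ + iᵏ xₙ|`, by polarization. -/
theorem IsTraceClass.exists_positive_decomposition {T : H →L[ℂ] H} (hT : IsTraceClass T) :
    ∃ (c : Fin 4 → ℂ) (P : Fin 4 → H →L[ℂ] H), (∀ k, IsTraceClass (P k)) ∧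
      (∀ k, (P k).IsPositive) ∧ ∀ A, trace (T * A) = ∑ k, c k * trace (P k * A) := by
  obtain ⟨x, y, h⟩ := hT.exists_nuclearRep
  have key : ∀ a : ℂ, ∃ P : H →L[ℂ] H, NuclearRep (fun n => y n + a • x n)
      (fun n => y n + a • x n) P := fun a => by
    have hx : Summable fun n => ‖a • x n‖ ^ 2 := by
      simpa only [norm_smul, mul_pow] using h.left.mul_left (‖a‖ ^ 2)
    have := summable_norm_add_sq h.right hx
    exact exists_nuclearRep_of_summable_sq this this
  choose P hP using key
  refine ⟨![1 / 4, -1 / 4, Complex.I / 4, -Complex.I / 4],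
    ![P 1, P (-1), P Complex.I, P (-Complex.I)], ?_, ?_, fun A => ?_⟩
  · intro k; fin_cases k <;> exact (hP _).isTraceClass
  · intro k; fin_cases k <;> exact (hP _).isPositive
  refine (h.hasSum_trace_mul A).unique ?_
  rw [Fin.sum_univ_four]
  have := ((((hP 1).hasSum_trace_mul A).mul_left (1 / 4)).add
    (((hP (-1)).hasSum_trace_mul A).mul_left (-1 / 4))).add
    (((hP Complex.I).hasSum_trace_mul A).mul_left (Complex.I / 4)) |>.add
    (((hP (-Complex.I)).hasSum_trace_mul A).mul_left (-Complex.I / 4))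
  simp only [← inner_map_eq_polarization] at this
  exact this

end PositiveTraceClass

/-! ### Product states -/

section ProductState

variable {H : Type u} [NormedAddCommGroup H] [InnerProductSpace ℂ H]

/-- The bounded linear map `y ↦ x ⊗ y`. -/
def pureTensorRight (x : H) : H →L[ℂ] HilbertTensor H :=
  LinearMap.mkContinuous
    { toFun := pureTensor x
      map_add' := fun y y' => by
        rw [pureTensor, TensorProduct.tmul_add, UniformSpace.Completion.coe_add]; rfl
      map_smul' := fun c y => by
        rw [pureTensor, TensorProduct.tmul_smul, UniformSpace.Completion.coe_smul]; rfl } ‖x‖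
    fun y => (norm_pureTensor x y).le

/-- The bounded linear map `x ↦ x ⊗ y`. -/
def pureTensorLeft (y : H) : H →L[ℂ] HilbertTensor H :=
  LinearMap.mkContinuous
    { toFun := fun x => pureTensor x y
      map_add' := fun x x' => by
        rw [pureTensor, TensorProduct.add_tmul, UniformSpace.Completion.coe_add]; rfl
      map_smul' := fun c x => by
        rw [pureTensor, ← TensorProduct.smul_tmul', UniformSpace.Completion.coe_smul]; rfl } ‖y‖
    fun x => (norm_pureTensor x y).le.trans_eq (mul_comm _ _)

theorem pureTensorRight_apply (x y : H) : pureTensorRight x y = pureTensor x y := rfl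

theorem pureTensorLeft_apply (x y : H) : pureTensorLeft y x = pureTensor x y := rfl

theorem smul_pureTensor_smul (a c : ℂ) (x y : H) :
    (a * c) • pureTensor x y = pureTensor (a • x) (c • y) := by
  rw [← pureTensorRight_apply (a • x), map_smul, pureTensorRight_apply, ← pureTensorLeft_apply,
    ← pureTensorLeft_apply, map_smul, smul_smul, mul_comm]

theorem eq_pureTensor_of_hasSum_prod {ι κ : Type*} {f : ι → H} {g : κ → H} {x y : H}
    {ξ : HilbertTensor H}
    (hf : HasSum f x) (hg : HasSum g y)
    (h : HasSum (fun p : ι × κ => pureTensor (f p.1) (g p.2)) ξ) : ξ = pureTensor x y := by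
  have h1 : HasSum (fun i => pureTensor (f i) y) ξ :=
    h.prod_fiberwise fun i => hg.mapL (pureTensorRight (f i))
  exact h1.unique (hf.mapL (pureTensorLeft y))

theorem summable_norm_pureTensor_sq {ι κ : Type*} {f : ι → H} {g : κ → H}
    (hf : Summable fun i => ‖f i‖ ^ 2) (hg : Summable fun i => ‖g i‖ ^ 2) :
    Summable fun p : ι × κ => ‖pureTensor (f p.1) (g p.2)‖ ^ 2 := by
  simp only [norm_pureTensor, mul_pow]
  exact hf.mul_of_nonneg hg (fun _ => sq_nonneg _) (fun _ => sq_nonneg _)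

theorem NuclearRep.opTensor {ι κ : Type*} {x y : ι → H} {x' y' : κ → H} {S T : H →L[ℂ] H}
    (hS : NuclearRep x y S) (hT : NuclearRep x' y' T) :
    NuclearRep (fun p : ι × κ => pureTensor (x p.1) (x' p.2))
      (fun p : ι × κ => pureTensor (y p.1) (y' p.2)) (opTensor S T) := by
  obtain ⟨R, hR⟩ := exists_nuclearRep_of_summable_sq (summable_norm_pureTensor_sq hS.left hT.left)
    (summable_norm_pureTensor_sq hS.right hT.right)
  have : R = QChannel.opTensor S T := hilbertTensor_ext fun u v => by
    have h := hR.hasSum (pureTensor u v)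
    simp only [inner_pureTensor, smul_pureTensor_smul] at h
    rw [opTensor_pureTensor]
    exact eq_pureTensor_of_hasSum_prod (hS.hasSum u) (hT.hasSum v) h
  rwa [← this]

theorem IsTraceClass.opTensor {S T : H →L[ℂ] H} (hS : IsTraceClass S) (hT : IsTraceClass T) :
    IsTraceClass (opTensor S T) := by
  obtain ⟨x, y, h⟩ := hS.exists_nuclearRep
  obtain ⟨x', y', h'⟩ := hT.exists_nuclearRep
  exact (h.opTensor h').isTraceClass

theorem eq_mul_of_hasSum_prod {ι κ : Type*} {f : ι → ℂ} {g : κ → ℂ} {a c s : ℂ}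
    (hf : HasSum f a) (hg : HasSum g c) (h : HasSum (fun p : ι × κ => f p.1 * g p.2) s) :
    s = a * c :=
  (h.prod_fiberwise fun i => hg.mul_left (f i)).unique (hf.mul_right c)

variable [CompleteSpace H]

theorem trace_opTensor_mul {S T : H →L[ℂ] H} (hS : IsTraceClass S) (hT : IsTraceClass T)
    (A B : H →L[ℂ] H) :
    trace (opTensor S T * opTensor A B) = trace (S * A) * trace (T * B) := by
  obtain ⟨x, y, h⟩ := hS.exists_nuclearRep
  obtain ⟨x', y', h'⟩ := hT.exists_nuclearRep
  have h1 := (h.opTensor h').hasSum_trace_mul (opTensor A B)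
  simp only [opTensor_pureTensor, inner_pureTensor] at h1
  exact eq_mul_of_hasSum_prod (h.hasSum_trace_mul A) (h'.hasSum_trace_mul B) h1

theorem IsDensityOperator.opTensor {ρ : H →L[ℂ] H} (hρ : IsDensityOperator ρ) :
    IsDensityOperator (opTensor ρ ρ) where
  isPositive := by
    obtain ⟨S, hS⟩ := isPositive_iff_exists_star_mul_self.1 hρ.isPositive
    exact isPositive_iff_exists_star_mul_self.2
      ⟨QChannel.opTensor S S, by rw [opTensor_star, opTensor_mul, hS]⟩
  isTraceClass := hρ.isTraceClass.opTensor hρ.isTraceClass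
  trace_eq_one := by
    have := trace_opTensor_mul hρ.isTraceClass hρ.isTraceClass 1 1
    rwa [opTensor_one, mul_one, mul_one, hρ.trace_eq_one, one_mul] at this

end ProductState

/-! ### Countable Hilbert bases and weakly measurable families -/

section Basis

variable {H : Type u} [NormedAddCommGroup H] [InnerProductSpace ℂ H]

theorem _root_.Orthonormal.countable [TopologicalSpace.SeparableSpace H] {ι : Type*} {v : ι → H}
    (hv : Orthonormal ℂ v) : Countable ι := by
  have hdist : ∀ i j, i ≠ j → 1 ≤ dist (v i) (v j) := fun i j hij => by
    have h := norm_sub_sq (𝕜 := ℂ) (v i) (v j)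
    rw [hv.2 hij, hv.1 i, hv.1 j] at h
    rw [dist_eq_norm]
    simp at h
    nlinarith [norm_nonneg (v i - v j)]
  refine Set.countable_univ_iff.1 <| Set.PairwiseDisjoint.countable_of_isOpen
    (s := fun i => Metric.ball (v i) (1 / 2)) ?_ (fun i _ => Metric.isOpen_ball)
    (fun i _ => Metric.nonempty_ball.2 (by norm_num))
  intro i _ j _ hij
  exact Metric.ball_disjoint_ball (by linarith [hdist i j hij])

theorem exists_hilbertBasis_hilbertTensor {κ : Type*} (b : HilbertBasis κ ℂ H) :
    ∃ c : HilbertBasis (κ × κ) ℂ (HilbertTensor H), ∀ p, c p = pureTensor (b p.1) (b p.2) := by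
  classical
  have hon : Orthonormal ℂ fun p : κ × κ => pureTensor (b p.1) (b p.2) := by
    have hb := orthonormal_iff_ite.1 b.orthonormal
    rw [orthonormal_iff_ite]
    intro p q
    rw [inner_pureTensor, hb, hb]
    by_cases h1 : p.1 = q.1 <;> by_cases h2 : p.2 = q.2 <;> simp [Prod.ext_iff, h1, h2]
  refine ⟨HilbertBasis.mkOfOrthogonalEqBot hon ?_, fun p => by
    rw [HilbertBasis.coe_mkOfOrthogonalEqBot]⟩
  rw [Submodule.eq_bot_iff]
  intro ξ hξ
  have h0 : ∀ i j, inner ℂ ξ (pureTensor (b i) (b j)) = 0 := fun i j =>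
    (Submodule.mem_orthogonal' _ ξ).1 hξ _ (Submodule.subset_span (Set.mem_range_self (i, j)))
  have h1 : ∀ i y, inner ℂ ξ (pureTensor (b i) y) = 0 := fun i y => by
    have := ((b.hasSum_repr y).mapL (pureTensorRight (b i))).mapL (innerSL ℂ ξ)
    simp only [map_smul, pureTensorRight_apply, innerSL_apply_apply, h0, smul_zero] at this
    exact this.unique hasSum_zero
  have h2 : ∀ x y, inner ℂ ξ (pureTensor x y) = 0 := fun x y => by
    have := ((b.hasSum_repr x).mapL (pureTensorLeft y)).mapL (innerSL ℂ ξ)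
    simp only [map_smul, pureTensorLeft_apply, innerSL_apply_apply, h1, smul_zero] at this
    exact this.unique hasSum_zero
  refine ext_inner_right ℂ fun η => ?_
  rw [inner_zero_left]
  exact hilbertTensor_induction (p := fun η => inner ℂ ξ η = 0)
    (isClosed_eq (by fun_prop) continuous_const)
    (fun η η' h h' => by rw [inner_add_right, h, h', add_zero]) (inner_zero_right _) h2 η

variable [CompleteSpace H]
variable {Ω : Type w} [MeasurableSpace Ω]

/-- Measurability of `λ ↦ tr (τ_λ A)` can be checked on the matrix elements of `τ` along a
countable Hilbert basis. -/
theorem measurable_trace_mul {κ : Type*} [Countable κ] (b : HilbertBasis κ ℂ H)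
    {τ : Ω → H →L[ℂ] H} (hτ : ∀ l, IsTraceClass (τ l))
    (hm : ∀ i j, Measurable fun l => inner ℂ (b i) (τ l (b j))) (A : H →L[ℂ] H) :
    Measurable fun l => trace (τ l * A) := by
  have h1 : ∀ i k, Measurable fun l => inner ℂ (b i) (τ l (A (b k))) := fun i k => by
    have : ∀ l, HasSum (fun j => b.repr (A (b k)) j * inner ℂ (b i) (τ l (b j)))
        (inner ℂ (b i) (τ l (A (b k)))) := fun l => by
      simpa [inner_smul_right] using
        ((b.hasSum_repr (A (b k))).mapL (τ l)).mapL (innerSL ℂ (b i))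
    simp only [← fun l => (this l).tsum_eq]
    exact Measurable.tsum fun j => (hm i j).const_mul _
  have h2 : ∀ l, HasSum (fun k => inner ℂ (b k) (τ l (A (b k)))) (trace (τ l * A)) := fun l =>
    ((hτ l).mul_right A).hasSum_diag b
  simp only [← fun l => (h2 l).tsum_eq]
  exact Measurable.tsum fun k => h1 k k

/-- The family of product states `σ_λ ⊗ σ_λ` is weakly measurable if `σ` is. -/
theorem measurable_trace_opTensor_mul [TopologicalSpace.SeparableSpace H] {σ : Ω → H →L[ℂ] H}
    (hσ : ∀ l, IsTraceClass (σ l)) (hm : ∀ A : H →L[ℂ] H, Measurable fun l => trace (σ l * A))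
    (C : HilbertTensor H →L[ℂ] HilbertTensor H) :
    Measurable fun l => trace (opTensor (σ l) (σ l) * C) := by
  obtain ⟨κ, b, -⟩ := exists_hilbertBasis ℂ H
  have := b.orthonormal.countable
  obtain ⟨c, hc⟩ := exists_hilbertBasis_hilbertTensor b
  refine measurable_trace_mul c (fun l => (hσ l).opTensor (hσ l)) (fun i j => ?_) C
  have hinner : ∀ x y, Measurable fun l => inner ℂ x (σ l y) := fun x y => by
    have := hm (InnerProductSpace.rankOne ℂ y x)
    simpa only [← trace_mul_comm (hσ _), trace_rankOne_mul] using this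
  simp only [hc, opTensor_pureTensor, inner_pureTensor]
  exact (hinner _ _).mul (hinner _ _)

end Basis

/-! ### Integration with respect to a POVM -/

section Integral

open scoped ComplexOrder

variable {H : Type u} [NormedAddCommGroup H] [InnerProductSpace ℂ H]

theorem exists_unit_vector {v : H} (hv : v ≠ 0) :
    ∃ u : H, ‖u‖ = 1 ∧ ∀ T : H →L[ℂ] H,
      inner ℂ v (T v) = ((‖v‖ ^ 2 : ℝ) : ℂ) * inner ℂ u (T u) := by
  have h0 := norm_ne_zero_iff.2 hv
  refine ⟨((‖v‖⁻¹ : ℝ) : ℂ) • v, ?_, fun T => ?_⟩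
  · rw [norm_smul, Complex.norm_real, norm_inv, norm_norm, inv_mul_cancel₀ h0]
  · rw [map_smul, inner_smul_left, inner_smul_right, Complex.conj_ofReal, ← mul_assoc, ← mul_assoc,
      ← Complex.ofReal_mul, ← Complex.ofReal_mul]
    have : ‖v‖ ^ 2 * ‖v‖⁻¹ * ‖v‖⁻¹ = 1 := by field_simp
    rw [this, Complex.ofReal_one, one_mul]

/-- A bound on the quadratic form of an operator controls its norm, by polarization. -/
theorem norm_le_of_quadratic {T : H →L[ℂ] H} {C : ℝ} (hC : 0 ≤ C)
    (h : ∀ v, ‖v‖ = 1 → ‖inner ℂ v (T v)‖ ≤ C) : ‖T‖ ≤ 4 * C := by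
  have hq : ∀ v, ‖inner ℂ v (T v)‖ ≤ C * ‖v‖ ^ 2 := fun v => by
    rcases eq_or_ne v 0 with rfl | hv
    · simp
    obtain ⟨u, hu, huT⟩ := exists_unit_vector hv
    rw [huT, norm_mul, Complex.norm_real, Real.norm_of_nonneg (by positivity), mul_comm]
    gcongr
    exact h u hu
  have hb : ∀ (x y : H) (a : ℂ), ‖x‖ = 1 → ‖y‖ = 1 → ‖a‖ = 1 →
      ‖inner ℂ (y + a • x) (T (y + a • x))‖ ≤ 4 * C := fun x y a hx hy ha => by
    have h1 : ‖y + a • x‖ ≤ 2 := (norm_add_le _ _).trans (by rw [norm_smul, hx, hy, ha]; norm_num)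
    have h2 : ‖y + a • x‖ ^ 2 ≤ 2 ^ 2 := by gcongr
    nlinarith [hq (y + a • x)]
  have hxy : ∀ x y : H, ‖x‖ = 1 → ‖y‖ = 1 → ‖inner ℂ x (T y)‖ ≤ 4 * C := fun x y hx hy => by
    rw [inner_map_eq_polarization]
    refine (norm_add₄_le).trans ?_
    simp only [norm_mul, norm_div, norm_neg, norm_one, Complex.norm_I, Complex.norm_ofNat]
    have h1 := hb x y 1 hx hy (by simp)
    have h2 := hb x y (-1) hx hy (by simp)
    have h3 := hb x y Complex.I hx hy (by simp)
    have h4 := hb x y (-Complex.I) hx hy (by simp)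
    linarith
  refine T.opNorm_le_of_unit_norm (by positivity) fun y hy => ?_
  rcases eq_or_ne (T y) 0 with h0 | h0
  · rw [h0, norm_zero]; positivity
  have hn := norm_ne_zero_iff.2 h0
  have := hxy (((‖T y‖⁻¹ : ℝ) : ℂ) • T y) y
    (by rw [norm_smul, Complex.norm_real, norm_inv, norm_norm, inv_mul_cancel₀ hn]) hy
  rwa [inner_smul_left, norm_mul, norm_inner_self_complex, Complex.conj_ofReal, Complex.norm_real,
    norm_inv, norm_norm, ← mul_assoc, inv_mul_cancel₀ hn, one_mul] at this

/-- Convergence of operators in the weak topology can be tested on unit vectors. -/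
theorem tendsto_inner_of_quadratic {α : Type*} {F : Filter α} {T : α → H →L[ℂ] H} {S : H →L[ℂ] H}
    (h : ∀ v, ‖v‖ = 1 → Tendsto (fun n => inner ℂ v (T n v)) F (𝓝 (inner ℂ v (S v)))) (x y : H) :
    Tendsto (fun n => inner ℂ x (T n y)) F (𝓝 (inner ℂ x (S y))) := by
  have hq : ∀ v, Tendsto (fun n => inner ℂ v (T n v)) F (𝓝 (inner ℂ v (S v))) := fun v => by
    rcases eq_or_ne v 0 with rfl | hv
    · simpa using tendsto_const_nhds
    obtain ⟨u, hu, huT⟩ := exists_unit_vector hv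
    simp only [huT]
    exact (h u hu).const_mul _
  simp only [inner_map_eq_polarization _ x y]
  exact ((((hq _).const_mul _).add ((hq _).const_mul _)).add ((hq _).const_mul _)).add
    ((hq _).const_mul _)

variable [CompleteSpace H] {Ω : Type w} [MeasurableSpace Ω] {G : Set Ω → (H →L[ℂ] H)}
  {f g : Ω → ℂ} {S T : H →L[ℂ] H}

/-- The outcome distribution of a POVM in the pure state `v`. -/
theorem IsPOVM.exists_measure (hG : IsPOVM G) {v : H} (hv : ‖v‖ = 1) : ∃ μ : Measure Ω,
    IsProbabilityMeasure μ ∧ (∀ X, MeasurableSet X → inner ℂ v (G X v) = (μ.real X : ℂ)) ∧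
    ∀ f T, IsPOVMIntegral G f T → inner ℂ v (T v) = ∫ l, f l ∂μ := by
  obtain ⟨μ, hμ⟩ := hG _ (isDensityOperator_rankOne hv)
  refine ⟨μ, hμ.1, fun X hX => ?_, fun f T hT => ?_⟩
  · rw [← hμ.2 X hX, trace_rankOne_mul]
  · rw [← (hT _ μ (isDensityOperator_rankOne hv) hμ).2, trace_rankOne_mul]

theorem IsPOVM.isPositive (hG : IsPOVM G) {X : Set Ω} (hX : MeasurableSet X) :
    (G X).IsPositive := isPositive_of_inner_nonneg fun v => by
  rcases eq_or_ne v 0 with rfl | hv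
  · simp
  obtain ⟨u, hu, huT⟩ := exists_unit_vector hv
  obtain ⟨μ, -, hμ, -⟩ := hG.exists_measure hu
  rw [huT, hμ X hX, ← Complex.ofReal_mul]
  exact Complex.zero_le_real.2 (by positivity)

theorem IsPOVMIntegral.norm_le (hG : IsPOVM G) (hT : IsPOVMIntegral G f T) {C : ℝ} (hC : 0 ≤ C)
    (hf : ∀ l, ‖f l‖ ≤ C) : ‖T‖ ≤ 4 * C := norm_le_of_quadratic hC fun v hv => by
  obtain ⟨μ, hμ, -, h⟩ := hG.exists_measure hv
  rw [h f T hT]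
  simpa using norm_integral_le_of_norm_le_const (μ := μ) (.of_forall hf)

/-- Dominated convergence for POVM integrals, with bounded integrands and in the weak topology. -/
theorem IsPOVMIntegral.tendsto (hG : IsPOVM G) {fs : ℕ → Ω → ℂ} {Ts : ℕ → H →L[ℂ] H} {C : ℝ}
    (hC : ∀ n l, ‖fs n l‖ ≤ C) (hm : ∀ n, Measurable (fs n))
    (hlim : ∀ l, Tendsto (fun n => fs n l) atTop (𝓝 (f l)))
    (hTs : ∀ n, IsPOVMIntegral G (fs n) (Ts n)) (hT : IsPOVMIntegral G f T) (x y : H) :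
    Tendsto (fun n => inner ℂ x (Ts n y)) atTop (𝓝 (inner ℂ x (T y))) := by
  refine tendsto_inner_of_quadratic (fun v hv => ?_) x y
  obtain ⟨μ, hμ, -, h⟩ := hG.exists_measure hv
  simp only [h _ _ hT, h _ _ (hTs _)]
  exact tendsto_integral_of_dominated_convergence (fun _ => C)
    (fun n => (hm n).aestronglyMeasurable) (integrable_const C) (fun n => .of_forall (hC n))
    (.of_forall hlim)

theorem IsPOVMIntegral.unique (hG : IsPOVM G) (hT : IsPOVMIntegral G f T)
    (hS : IsPOVMIntegral G f S) : T = S :=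
  ext_inner_operator fun x y => by
    refine tendsto_nhds_unique (tendsto_const_nhds (f := (atTop : Filter ℕ)))
      (tendsto_inner_of_quadratic (T := fun _ => T) (fun v hv => ?_) x y)
    obtain ⟨μ, hμ, -, h⟩ := hG.exists_measure hv
    rw [h _ _ hT, h _ _ hS]
    exact tendsto_const_nhds

theorem IsPOVMIntegral.add (hT : IsPOVMIntegral G f T) (hS : IsPOVMIntegral G g S) :
    IsPOVMIntegral G (fun l => f l + g l) (T + S) := fun ρ μ hρ hμ => by
  obtain ⟨h1, h2⟩ := hT ρ μ hρ hμ
  obtain ⟨h3, h4⟩ := hS ρ μ hρ hμ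
  exact ⟨h1.add h3, by rw [trace_mul_add hρ.isTraceClass, h2, h4, integral_add h1 h3]⟩

theorem IsPOVMIntegral.const_mul (hT : IsPOVMIntegral G f T) (c : ℂ) :
    IsPOVMIntegral G (fun l => c * f l) (c • T) := fun ρ μ hρ hμ => by
  obtain ⟨h1, h2⟩ := hT ρ μ hρ hμ
  exact ⟨h1.const_mul c, by rw [trace_mul_smul hρ.isTraceClass, h2, integral_const_mul]⟩

theorem isPOVMIntegral_one : IsPOVMIntegral G (fun _ => 1) 1 := fun ρ μ hρ hμ => by
  have := hμ.1
  exact ⟨integrable_const _, by rw [mul_one, hρ.trace_eq_one]; simp⟩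

/-- The integral of a function of a simple function is a finite sum. -/
theorem isPOVMIntegral_simpleFunc {E : Type*} [NormedAddCommGroup E] (s : SimpleFunc Ω E)
    (φ : E → ℂ) (hφ : φ 0 = 0) :
    IsPOVMIntegral G (fun l => φ (s l)) (∑ a ∈ s.range, φ a • G (s ⁻¹' {a})) := fun ρ μ hρ hμ => by
  have := hμ.1
  have hint : Integrable (s.map φ) μ := SimpleFunc.integrable_of_isFiniteMeasure _
  refine ⟨hint, ?_⟩
  have h1 : ∫ l, φ (s l) ∂μ = (s.map φ).integral μ :=
    (SimpleFunc.integral_eq_integral _ hint).symm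
  rw [h1, SimpleFunc.map_integral s φ (SimpleFunc.integrable_of_isFiniteMeasure _) hφ,
    ← traceMul_apply hρ.isTraceClass, map_sum]
  refine Finset.sum_congr rfl fun a _ => ?_
  rw [map_smul, traceMul_apply, hμ.2 _ (s.measurableSet_fiber a), smul_eq_mul, mul_comm]
  simp

/-- Bounded measurable functions are integrable: the integral is a weak limit point of integrals
of simple functions. -/
theorem IsPOVM.exists_integral (hG : IsPOVM G) (hf : Measurable f) {C : ℝ} (hC : 0 ≤ C)
    (hfC : ∀ l, ‖f l‖ ≤ C) : ∃ T, IsPOVMIntegral G f T := by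
  have hs := hf.stronglyMeasurable
  set s := fun n => hs.approxBounded C n
  have hsC : ∀ n l, ‖s n l‖ ≤ C := fun n l => hs.norm_approxBounded_le hC n l
  choose Ts hTs using fun n => (⟨_, isPOVMIntegral_simpleFunc (s n) id rfl⟩ :
    ∃ T, IsPOVMIntegral G (fun l => id (s n l)) T)
  have hTC : ∀ n, ‖Ts n‖ ≤ 4 * C := fun n => (hTs n).norm_le hG hC (hsC n)
  -- the integrals of the simple functions are bounded, so they have a weak limit point
  set F : Ultrafilter ℕ := Ultrafilter.of atTop
  have hF : (F : Filter ℕ) ≤ atTop := Ultrafilter.of_le atTop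
  obtain ⟨T, -, hT⟩ := exists_weak_limit F Ts hTC
  refine ⟨T, fun ρ μ hρ hμ => ?_⟩
  have := hμ.1
  refine ⟨(integrable_const C).mono' hf.aestronglyMeasurable (.of_forall hfC), ?_⟩
  refine tendsto_nhds_unique (tendsto_trace_mul hTC hT hρ.isTraceClass) ?_
  simp only [(hTs _ ρ μ hρ hμ).2]
  exact (tendsto_integral_of_dominated_convergence (fun _ => C)
    (fun n => (s n).aestronglyMeasurable) (integrable_const C) (fun n => .of_forall (hsC n))
    (.of_forall fun l => hs.tendsto_approxBounded_of_norm_le (hfC l))).mono_left hF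

/-- Integration against a POVM is completely positive: a matrix of functions whose values are
positive matrices is integrated to a positive operator matrix. Positivity of the matrix `(aᵢⱼ)`
enters in the form `∑ᵢⱼ aᵢⱼ ⟨yᵢ, yⱼ⟩ ≥ 0` for all vectors `yᵢ` of `H`. -/
theorem IsPOVM.sum_inner_integral_nonneg (hG : IsPOVM G) {k : ℕ} {f : Ω → Fin k → Fin k → ℂ}
    {T : Fin k → Fin k → H →L[ℂ] H} (hf : Measurable f) {C : ℝ} (hfC : ∀ l, ‖f l‖ ≤ C)
    (hpos : ∀ l, ∀ y : Fin k → H, 0 ≤ ∑ i, ∑ j, f l i j * inner ℂ (y i) (y j))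
    (hT : ∀ i j, IsPOVMIntegral G (fun l => f l i j) (T i j)) (x : Fin k → H) :
    0 ≤ ∑ i, ∑ j, inner ℂ (x i) (T i j (x j)) := by
  set s : Set (Fin k → Fin k → ℂ) :=
    {a | ∀ y : Fin k → H, 0 ≤ ∑ i, ∑ j, a i j * inner ℂ (y i) (y j)}
  have hs0 : (0 : Fin k → Fin k → ℂ) ∈ s := fun y => by simp
  -- approximation by simple functions with values in the closed cone `s` of positive matrices
  set F := fun n => SimpleFunc.approxOn f hf s 0 hs0 n
  set Ts : ℕ → Fin k → Fin k → H →L[ℂ] H := fun n i j =>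
    ∑ a ∈ (F n).range, a i j • G (F n ⁻¹' {a})
  have hTs : ∀ n i j, IsPOVMIntegral G (fun l => F n l i j) (Ts n i j) := fun n i j =>
    isPOVMIntegral_simpleFunc (F n) (fun a => a i j) rfl
  have hF : ∀ n l, F n l ∈ s := fun n l => SimpleFunc.approxOn_mem hf hs0 n l
  have hFC : ∀ n l i j, ‖F n l i j‖ ≤ C + C := fun n l i j =>
    ((norm_le_pi_norm (F n l i) j).trans (norm_le_pi_norm (F n l) i)).trans
      ((SimpleFunc.norm_approxOn_zero_le hf hs0 l n).trans (add_le_add (hfC l) (hfC l)))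
  have hlim : ∀ l i j, Tendsto (fun n => F n l i j) atTop (𝓝 (f l i j)) := fun l i j =>
    tendsto_pi_nhds.1 (tendsto_pi_nhds.1
      (SimpleFunc.tendsto_approxOn hf hs0 (subset_closure (hpos l))) i) j
  have hTlim : Tendsto (fun n => ∑ i, ∑ j, inner ℂ (x i) (Ts n i j (x j))) atTop
      (𝓝 (∑ i, ∑ j, inner ℂ (x i) (T i j (x j)))) :=
    tendsto_finsetSum _ fun i _ => tendsto_finsetSum _ fun j _ =>
      IsPOVMIntegral.tendsto hG (fun n l => hFC n l i j)
        (fun n => measurable_pi_iff.1 (measurable_pi_iff.1 (F n).measurable i) j)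
        (fun l => hlim l i j) (fun n => hTs n i j) (hT i j) _ _
  refine ge_of_tendsto' hTlim fun n => ?_
  have h1 : ∑ i, ∑ j, inner ℂ (x i) (Ts n i j (x j)) =
      ∑ a ∈ (F n).range, ∑ i, ∑ j, a i j * inner ℂ (x i) (G (F n ⁻¹' {a}) (x j)) := by
    simp only [Ts, _root_.sum_apply, _root_.smul_apply, inner_sum, inner_smul_right]
    exact Finset.sum_comm_cycle
  rw [h1]
  refine Finset.sum_nonneg fun a ha => ?_
  obtain ⟨l, rfl⟩ := SimpleFunc.mem_range.1 ha
  obtain ⟨R, hR⟩ := isPositive_iff_exists_star_mul_self.1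
    (hG.isPositive ((F n).measurableSet_fiber (F n l)))
  simp only [hR, mul_apply_eq_comp, inner_star_right]
  exact hF n l fun i => R (x i)

end Integral

/-! ### Measure-and-prepare channels -/

section MeasureAndPrepare

open scoped ComplexOrder

variable {K : Type u} [NormedAddCommGroup K] [InnerProductSpace ℂ K] [CompleteSpace K]
variable {Ω : Type w} [MeasurableSpace Ω] {τ : Ω → K →L[ℂ] K}

theorem trace_mul_rankOne (T : K →L[ℂ] K) (x y : K) :
    trace (T * InnerProductSpace.rankOne ℂ y x) = inner ℂ x (T y) := by
  rw [trace_mul_comm (isTraceClass_rankOne y x), trace_rankOne_mul]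

theorem integrable_trace_mul {μ : Measure Ω} [IsProbabilityMeasure μ]
    (hτ : ∀ l, IsDensityOperator (τ l)) (hm : ∀ A : K →L[ℂ] K, Measurable fun l => trace (τ l * A))
    (A : K →L[ℂ] K) : Integrable (fun l => trace (τ l * A)) μ :=
  (integrable_const ‖A‖).mono' (hm A).aestronglyMeasurable
    (.of_forall fun l => (hτ l).norm_trace_mul_le A)

/-- The mixture `∫ τ_λ dμ(λ)` of a measurable family of states exists as a trace-class operator.
It is defined through its sesquilinear form and is nuclear because it is positive with summable
diagonal. -/
theorem exists_mixture {κ : Type*} [Countable κ] (b : HilbertBasis κ ℂ K) (μ : Measure Ω)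
    [IsProbabilityMeasure μ] (hτ : ∀ l, IsDensityOperator (τ l))
    (hm : ∀ A : K →L[ℂ] K, Measurable fun l => trace (τ l * A)) :
    ∃ T : K →L[ℂ] K, IsTraceClass T ∧ ∀ C, trace (T * C) = ∫ l, trace (τ l * C) ∂μ := by
  have hint : ∀ x y, Integrable (fun l => inner ℂ x (τ l y)) μ := fun x y => by
    simpa only [trace_mul_rankOne] using
      integrable_trace_mul (μ := μ) hτ hm (InnerProductSpace.rankOne ℂ y x)
  have hbound : ∀ x y l, ‖inner ℂ x (τ l y)‖ ≤ ‖x‖ * ‖y‖ := fun x y l => by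
    rw [← trace_mul_rankOne, mul_comm, ← InnerProductSpace.norm_rankOne (𝕜 := ℂ)]
    exact (hτ l).norm_trace_mul_le _
  obtain ⟨T, -, hT⟩ := exists_operator_of_sesquilinear (fun x y : K => ∫ l, inner ℂ x (τ l y) ∂μ) 1
    zero_le_one (fun x x' y => by simp only [inner_add_left, integral_add (hint _ _) (hint _ _)])
    (fun c x y => by simp only [inner_smul_left, integral_const_mul]; rfl)
    (fun x y y' => by
      simp only [map_add, inner_add_right, integral_add (hint _ _) (hint _ _)])
    (fun c x y => by simp only [map_smul, inner_smul_right, integral_const_mul])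
    (fun x y => by
      simpa using norm_integral_le_of_norm_le_const (μ := μ) (.of_forall (hbound x y)))
  have hpos : T.IsPositive := isPositive_of_inner_nonneg fun v => by
    rw [hT]
    exact integral_nonneg fun l => inner_map_self_nonneg (hτ l).isPositive v
  -- exchange of sum and integral; the series of absolute values sums to `tr (τ_λ R⋆ R) ≤ ‖R⋆ R‖`
  have hsum : ∀ R : K →L[ℂ] K, HasSum (fun k => inner ℂ (star R (b k)) (T (star R (b k))))
      (∫ l, trace (τ l * (star R * R)) ∂μ) := fun R => by
    simp only [hT]
    have hs := fun l => hasSum_trace_mul_star_mul_self (hτ l).isTraceClass b R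
    have hnorm : ∀ k l, ‖inner ℂ (star R (b k)) (τ l (star R (b k)))‖ =
        (inner ℂ (star R (b k)) (τ l (star R (b k)))).re := fun k l =>
      (Complex.re_eq_norm.2 (inner_map_self_nonneg (hτ l).isPositive _)).symm
    have hs' : ∀ l, HasSum (fun k => ‖inner ℂ (star R (b k)) (τ l (star R (b k)))‖)
        (trace (τ l * (star R * R))).re := fun l => by
      simpa only [hnorm, Complex.reCLM_apply] using (hs l).mapL Complex.reCLM
    refine hasSum_integral_of_dominated_convergence
      (fun k l => ‖inner ℂ (star R (b k)) (τ l (star R (b k)))‖)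
      (fun k => (hint _ _).aestronglyMeasurable) (fun k => .of_forall fun l => le_rfl)
      (.of_forall fun l => (hs' l).summable) ?_ (.of_forall hs)
    simp only [(hs' _).tsum_eq]
    exact (integrable_trace_mul hτ hm _).re
  have htc : IsTraceClass T := by
    obtain ⟨z, hz⟩ := exists_nuclearRep_of_summable_diag hpos b (by simpa using (hsum 1).summable)
    exact hz.isTraceClass
  refine ⟨T, htc, fun C => ?_⟩
  obtain ⟨P, hP, -, rfl⟩ := CStarAlgebra.exists_sum_four_nonneg C
  have hPi : ∀ i, trace (T * P i) = ∫ l, trace (τ l * P i) ∂μ := fun i => by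
    obtain ⟨R, hR⟩ := nonneg_iff_exists_star_mul_self.1 (hP i)
    rw [hR]
    exact (hasSum_trace_mul_star_mul_self htc b R).unique (hsum R)
  have hlin : ∀ {S : K →L[ℂ] K}, IsTraceClass S →
      trace (S * ∑ i : Fin 4, Complex.I ^ (i : ℕ) • P i) =
      ∑ i : Fin 4, Complex.I ^ (i : ℕ) * trace (S * P i) := fun hS => by
    rw [← traceMul_apply hS, map_sum]
    simp
  simp only [hlin htc, hlin (hτ _).isTraceClass, hPi]
  rw [integral_finsetSum _ fun i _ => (integrable_trace_mul hτ hm _).const_mul _]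
  simp only [integral_const_mul]

/-- For a positive trace-class `T = ∑ₖ |zₖ⟩⟨zₖ|` and a positive operator matrix `(Mᵢⱼ)`, the scalar
matrix `(tr (T Mᵢⱼ))` is positive. Expanding `yᵢ` in a basis `bₘ`, the form below is the sum over
`k` and `m` of the forms of `M` at the vectors `⟨bₘ, yᵢ⟩ zₖ`. -/
theorem sum_trace_mul_inner_nonneg {H : Type*} [NormedAddCommGroup H] [InnerProductSpace ℂ H]
    [CompleteSpace H] {n : Type*} [Fintype n] {T : K →L[ℂ] K} (hT : IsTraceClass T)
    (hpos : T.IsPositive) {M : n → n → K →L[ℂ] K}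
    (hM : ∀ x : n → K, 0 ≤ ∑ i, ∑ j, inner ℂ (x i) (M i j (x j))) (y : n → H) :
    0 ≤ ∑ i, ∑ j, trace (T * M i j) * inner ℂ (y i) (y j) := by
  obtain ⟨κ, z, hz⟩ := hT.exists_nuclearRep_self hpos
  obtain ⟨_, b, -⟩ := exists_hilbertBasis ℂ H
  have h1 : ∀ k, 0 ≤ ∑ i, ∑ j, inner ℂ (z k) (M i j (z k)) * inner ℂ (y i) (y j) := fun k => by
    have h2 : HasSum (fun m => ∑ i, ∑ j, inner ℂ (z k) (M i j (z k)) *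
        (inner ℂ (y i) (b m) * inner ℂ (b m) (y j)))
        (∑ i, ∑ j, inner ℂ (z k) (M i j (z k)) * inner ℂ (y i) (y j)) :=
      hasSum_sum fun i _ => hasSum_sum fun j _ => (b.hasSum_inner_mul_inner _ _).mul_left _
    refine h2.nonneg fun m => ?_
    have h3 := hM fun i => (inner ℂ (b m) (y i) : ℂ) • z k
    simp only [map_smul, inner_smul_left, inner_smul_right, inner_conj_symm] at h3
    exact h3.trans_eq (Finset.sum_congr rfl fun i _ => Finset.sum_congr rfl fun j _ => by ring)
  have h4 : HasSum (fun k => ∑ i, ∑ j, inner ℂ (z k) (M i j (z k)) * inner ℂ (y i) (y j))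
      (∑ i, ∑ j, trace (T * M i j) * inner ℂ (y i) (y j)) :=
    hasSum_sum fun i _ => hasSum_sum fun j _ => (hz.hasSum_trace_mul _).mul_right _
  exact h4.nonneg h1

variable {H : Type u} [NormedAddCommGroup H] [InnerProductSpace ℂ H] [CompleteSpace H]
  {G : Set Ω → (H →L[ℂ] H)}

/-- Measuring a POVM and preparing the state `τ_λ` on outcome `λ` is a channel. -/
theorem exists_measureAndPrepare {κ : Type*} [Countable κ] (b : HilbertBasis κ ℂ K)
    (hG : IsPOVM G) (hτ : ∀ l, IsDensityOperator (τ l))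
    (hm : ∀ A : K →L[ℂ] K, Measurable fun l => trace (τ l * A)) :
    ∃ Φ : (K →L[ℂ] K) →CP (H →L[ℂ] H), IsChannel Φ ∧
      ∀ C, IsPOVMIntegral G (fun l => trace (τ l * C)) (Φ C) := by
  have hex : ∀ C, ∃ T, IsPOVMIntegral G (fun l => trace (τ l * C)) T := fun C =>
    hG.exists_integral (hm C) (norm_nonneg C) fun l => (hτ l).norm_trace_mul_le C
  choose E hE using hex
  let φ : (K →L[ℂ] K) →ₗ[ℂ] (H →L[ℂ] H) :=
    { toFun := E
      map_add' := fun A B => (hE _).unique hG <| by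
        simpa only [trace_mul_add (hτ _).isTraceClass] using (hE A).add (hE B)
      map_smul' := fun c A => (hE _).unique hG <| by
        simpa only [trace_mul_smul (hτ _).isTraceClass, RingHom.id_apply] using (hE A).const_mul c }
  have hφ : ∀ (k : ℕ) (M : Fin k → Fin k → K →L[ℂ] K),
      (∀ x : Fin k → K, 0 ≤ ∑ i, ∑ j, inner ℂ (x i) (M i j (x j))) →
      ∀ x : Fin k → H, 0 ≤ ∑ i, ∑ j, inner ℂ (x i) (φ (M i j) (x j)) := fun k M hM x =>
    hG.sum_inner_integral_nonneg (f := fun l i j => trace (τ l * M i j)) (C := ‖M‖)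
      (measurable_pi_iff.2 fun i => measurable_pi_iff.2 fun j => hm _)
      (fun l => (pi_norm_le_iff_of_nonneg (norm_nonneg _)).2 fun i =>
        (pi_norm_le_iff_of_nonneg (norm_nonneg _)).2 fun j =>
          ((hτ l).norm_trace_mul_le _).trans
            ((norm_le_pi_norm (M i) j).trans (norm_le_pi_norm M i)))
      (fun l y => sum_trace_mul_inner_nonneg (hτ l).isTraceClass (hτ l).isPositive hM y)
      (fun i j => hE (M i j)) x
  refine ⟨cpOfForm φ hφ, ⟨?_, fun T hT => ?_⟩, hE⟩
  · refine (hE 1).unique hG ?_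
    simpa only [mul_one, (hτ _).trace_eq_one] using isPOVMIntegral_one
  · have hpos : ∀ P : H →L[ℂ] H, IsTraceClass P → P.IsPositive → ∃ P' : K →L[ℂ] K,
        IsTraceClass P' ∧ ∀ A, trace (P * E A) = trace (P' * A) := fun P hP hPpos => by
      -- normalize `P` to a state, unless `P` has trace zero and its functional vanishes
      rcases eq_or_ne (trace P) 0 with h0 | h0
      · refine ⟨0, isTraceClass_zero, fun A => ?_⟩
        have := norm_trace_mul_le hP hPpos (E A)
        rw [h0, Complex.zero_re, zero_mul, norm_le_zero_iff] at this
        rw [this, zero_mul]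
        simp [trace]
      · have hP1 : IsDensityOperator ((trace P)⁻¹ • P) :=
          ⟨by
            have h1 := trace_mul_nonneg hP hPpos
              (ContinuousLinearMap.isPositive_one (E := H) (𝕜 := ℂ))
            rw [mul_one] at h1
            refine isPositive_of_inner_nonneg fun v => ?_
            rw [_root_.smul_apply, inner_smul_right]
            exact mul_nonneg (inv_nonneg.2 h1) (inner_map_self_nonneg hPpos v),
            hP.smul _, by rw [trace_smul _ hP, inv_mul_cancel₀ h0]⟩
        obtain ⟨μ, hμ⟩ := hG _ hP1
        have := hμ.1
        obtain ⟨P', hP', h⟩ := exists_mixture b μ hτ hm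
        refine ⟨trace P • P', hP'.smul _, fun A => ?_⟩
        have h2 := (hE A _ μ hP1 hμ).2
        rw [← h, smul_mul_assoc, trace_smul _ (hP.mul_right _)] at h2
        rw [smul_mul_assoc, trace_smul _ (hP'.mul_right _), ← h2, mul_inv_cancel_left₀ h0]
    obtain ⟨c, P, hP, hPpos, hdec⟩ := hT.exists_positive_decomposition
    choose P' hP' hPP' using fun k => hpos (P k) (hP k) (hPpos k)
    refine ⟨∑ k, c k • P' k, IsTraceClass.sum _ fun k _ => (hP' k).smul _, fun A => ?_⟩
    change trace (T * E A) = _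
    rw [hdec, Finset.sum_mul]
    simp only [hPP', Fin.sum_univ_four, smul_mul_assoc]
    have htc : ∀ k, IsTraceClass (c k • (P' k * A)) := fun k => ((hP' k).mul_right A).smul _
    rw [trace_add (((htc 0).add (htc 1)).add (htc 2)) (htc 3),
      trace_add ((htc 0).add (htc 1)) (htc 2), trace_add (htc 0) (htc 1)]
    simp only [trace_smul _ ((hP' _).mul_right A)]

end MeasureAndPrepare

/-! ### Entanglement breaking channels as marginals -/

section EntanglementBreaking

variable {H : Type u} [NormedAddCommGroup H] [InnerProductSpace ℂ H] [CompleteSpace H]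
variable {Ω : Type w} [MeasurableSpace Ω] {G : Set Ω → (H →L[ℂ] H)} {σ : Ω → H →L[ℂ] H}
  {Λ : (H →L[ℂ] H) →ₗ[ℂ] (H →L[ℂ] H)}

/-- An entanglement breaking channel is the marginal of the symmetric channel that prepares two
copies of the state `σ_λ`. -/
theorem IsEBChannel.exists_symmetric [TopologicalSpace.SeparableSpace H]
    (h : IsEBChannel G σ Λ) :
    ∃ Φ : (HilbertTensor H →L[ℂ] HilbertTensor H) →CP (H →L[ℂ] H), IsSymmetricChannel Φ ∧
      marginal Φ = Λ ∧ ∀ C : HilbertTensor H →L[ℂ] HilbertTensor H,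
        IsPOVMIntegral G (fun l => trace (opTensor (σ l) (σ l) * C)) (Φ C) := by
  have htc := fun l => (h.isState l).isTraceClass
  obtain ⟨κ, b, -⟩ := exists_hilbertBasis ℂ H
  have := b.orthonormal.countable
  obtain ⟨c, -⟩ := exists_hilbertBasis_hilbertTensor b
  obtain ⟨Φ, hΦ, hint⟩ := exists_measureAndPrepare c h.isPOVM (fun l => (h.isState l).opTensor)
    (measurable_trace_opTensor_mul htc h.measurable)
  have hAB := fun A B => hint (opTensor A B)
  simp only [trace_opTensor_mul (htc _) (htc _)] at hAB
  refine ⟨Φ, ⟨hΦ, fun A B => (hAB A B).unique h.isPOVM ?_⟩, LinearMap.ext fun A => ?_, hint⟩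
  · simpa only [mul_comm] using hAB B A
  · refine IsPOVMIntegral.unique h.isPOVM (hAB A 1) ?_
    simpa only [mul_one, (h.isState _).trace_eq_one] using h.eq_integral A

end EntanglementBreaking

end QChannel

end

theorem mainTheorem6 {H : Type*} [NormedAddCommGroup H] [InnerProductSpace ℂ H]
    [CompleteSpace H] [TopologicalSpace.SeparableSpace H] :
    (∀ Φ : (QChannel.HilbertTensor H →L[ℂ] QChannel.HilbertTensor H) →CP (H →L[ℂ] H),
      QChannel.IsSymmetricChannel Φ →
        (∃ ψ₀ : (H →L[ℂ] H) →CP (H →L[ℂ] H),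
          QChannel.IsFixedPointProjection (QChannel.marginal Φ) ψ₀ ∧
          QChannel.IsCesaroLimit (QChannel.marginal Φ) ψ₀) ∧
        ∀ ψ₀ : (H →L[ℂ] H) →CP (H →L[ℂ] H),
          QChannel.IsFixedPointProjection (QChannel.marginal Φ) ψ₀ →
          QChannel.IsCommVonNeumannProduct (QChannel.fixedPoints (QChannel.marginal Φ))
            (QChannel.broadcastProduct Φ ψ₀)) ∧
    ∀ (Ω : Type*) [MeasurableSpace Ω] [StandardBorelSpace Ω]
      (G : Set Ω → (H →L[ℂ] H)) (σ : Ω → (H →L[ℂ] H)) (Λ : (H →L[ℂ] H) →ₗ[ℂ] (H →L[ℂ] H)),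
      QChannel.IsEBChannel G σ Λ →
        (∃ m : QChannel.fixedPoints Λ → QChannel.fixedPoints Λ → (H →L[ℂ] H),
          QChannel.IsCommVonNeumannProduct (QChannel.fixedPoints Λ) m) ∧
        ∃ Φ : (QChannel.HilbertTensor H →L[ℂ] QChannel.HilbertTensor H) →CP (H →L[ℂ] H),
          QChannel.IsSymmetricChannel Φ ∧
          QChannel.marginal Φ = Λ ∧
          ∀ C : QChannel.HilbertTensor H →L[ℂ] QChannel.HilbertTensor H,
            QChannel.IsPOVMIntegral G
              (fun l => QChannel.trace (QChannel.opTensor (σ l) (σ l) * C)) (Φ C) := by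
  refine ⟨fun Φ hΦ => ⟨QChannel.exists_fixedPointProjection_marginal hΦ.isChannel, fun ψ hψ =>
    QChannel.isCommVonNeumannProduct_broadcastProduct hΦ hψ⟩, fun Ω _ _ G σ Λ h => ?_⟩
  obtain ⟨Φ, hΦ, rfl, hint⟩ := h.exists_symmetric
  obtain ⟨ψ, hψ, -⟩ := QChannel.exists_fixedPointProjection_marginal hΦ.isChannel
  exact ⟨⟨_, QChannel.isCommVonNeumannProduct_broadcastProduct hΦ hψ⟩, Φ, hΦ, rfl, hint⟩
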